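/- Let $\lambda_p,\sigma,P_d,\theta>0$ and $\alpha>2$. Consider a Poisson cluster process in $\mathbb R^2$: the cluster centers $\{x_i\}$ form a homogeneous Poisson point process of density $\lambda_p$, and every cluster has the same number $n$ of members, whose displacements from the cluster center are independent with density $f_Y(y)=\frac1{2\pi\sigma^2}e^{-\|y\|^2/(2\sigma^2)}$. In every cluster $i$ one D2D link is active, between two distinct members, a transmitter at $x_i+y_i$ and a receiver at $w_i=x_i+z_i$. The power gains $g_{ij}$ of the channels from the transmitter of cluster $j$ to the receiver of cluster $i$ are i.i.d. exponential with mean $1$ (Rayleigh fading), and the centers, the displacements, the gains and the choice of the active members are independent. All transmitters use power $P_d$, the path loss exponent is $\alpha$, and noise is neglected, so that $$\mathrm{SIR}_i=\frac{P_d\,g_{ii}\,\|x_i+y_i-w_i\|^{-\alpha}}{\sum_{j\ne i}P_d\,g_{ij}\,\|x_j+y_j-w_i\|^{-\alpha}} .$$ Let $p_{c_d}$ be the D2D coverage probability, i.e. the probability that the typical receiver (placed at the origin) has $\mathrm{SIR}>\theta$. In terms of Palm probabilities, for a Borel set $B$ with $0<|B|<\infty$, $$p_{c_d}=\frac{\mathbb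 E\,\#\{i: w_i\in B,\ \mathrm{SIR}_i>\theta\}}{\mathbb E\,\#\{i: w_i\in B\}} .$$ Then, for every such $B$ (so that the ratio does not depend on $B$), $$p_{c_d}=\frac{1}{4\sigma^2\mathcal Z(\theta,\alpha,\sigma)},\qquad \mathcal Z(\theta,\alpha,\sigma)=\pi\lambda_p\theta^{2/\alpha}\,\Gamma\!\left(1+\tfrac2\alpha\right)\Gamma\!\left(1-\tfrac2\alpha\right)+\frac1{4\sigma^2}.$$ -/

import Mathlib

open MeasureTheory ProbabilityTheory
open scoped ENNReal NNReal

noncomputable section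

/-- The Euclidean plane. -/
abbrev Plane : Type := EuclideanSpace ℝ (Fin 2)

/-- The number of indices `i` with `X i ω ∈ B`, i.e. the number of points in `B`
(counted with multiplicity) of the point process that the sequence `X` enumerates. -/
def pointCount {Ω : Type*} (X : ℕ → Ω → Plane) (B : Set Plane) (ω : Ω) : ℝ≥0∞ :=
  ∑' i, B.indicator (fun _ => 1) (X i ω)

/-- `X` enumerates the points of a homogeneous Poisson point process on the plane with
density `lam`: the number of points in a Borel set of finite area is Poisson distributed with
mean `lam` times the area, and the numbers of points in disjoint such sets are independent. -/
structure IsPoissonProcess {Ω : Type*} [MeasurableSpace Ω] (μ : Measure Ω) (lam : ℝ)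
    (X : ℕ → Ω → Plane) : Prop where
  measurable : ∀ i, Measurable (X i)
  count_law : ∀ B : Set Plane, MeasurableSet B → volume B ≠ ∞ →
    μ.map (pointCount X B) =
      (poissonMeasure (ENNReal.ofReal lam * volume B).toNNReal).map (fun k : ℕ => (k : ℝ≥0∞))
  count_indep : ∀ (m : ℕ) (B : Fin m → Set Plane), (∀ k, MeasurableSet (B k)) →
    (∀ k, volume (B k) ≠ ∞) → Pairwise (fun k l => Disjoint (B k) (B l)) →
    iIndepFun (fun k => pointCount X (B k)) μ

/-- The law with density `y ↦ exp (-‖y‖² / (2 σ²)) / (2 π σ²)` on the plane. -/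
def displacementLaw (σ : ℝ) : Measure Plane :=
  volume.withDensity fun y =>
    ENNReal.ofReal (1 / (2 * Real.pi * σ ^ 2) * Real.exp (-‖y‖ ^ 2 / (2 * σ ^ 2)))

/-- The random ingredients of a clustered device-to-device network in which every cluster has
`n` members and one active link. -/
structure D2DNetwork (Ω : Type*) (n : ℕ) where
  /-- the cluster centers (parent points) -/
  center : ℕ → Ω → Plane
  /-- the displacement of member `k` of cluster `i` from the cluster center -/
  displacement : ℕ → Fin n → Ω → Plane
  /-- the member of cluster `i` that transmits -/
  tx : ℕ → Ω → Fin n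
  /-- the member of cluster `i` that requests and receives -/
  rx : ℕ → Ω → Fin n
  /-- the power gain of the channel from the transmitter of cluster `j` to the receiver of
  cluster `i` is `fading i j` -/
  fading : ℕ → ℕ → Ω → ℝ

namespace D2DNetwork

variable {Ω : Type*} {n : ℕ}

/-- The Poisson cluster process with Gaussian displacements and Rayleigh fading: the centers
form a Poisson point process of density `lam`, the displacements are independent with the
isotropic normal law of variance `σ²` per coordinate, the channel gains are independent and
exponential with mean one, the transmitter and the receiver of a cluster are distinct members,
and the four families (centers, displacements, gains, scheduling) are independent. -/
structure IsGaussianRayleigh [MeasurableSpace Ω] (N : D2DNetwork Ω n) (μ : Measure Ω)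
    (lam σ : ℝ) : Prop where
  poisson : IsPoissonProcess μ lam N.center
  measurable_displacement : ∀ i k, Measurable (N.displacement i k)
  displacement_law : ∀ i k, μ.map (N.displacement i k) = displacementLaw σ
  displacement_indep : iIndepFun (fun p : ℕ × Fin n => N.displacement p.1 p.2) μ
  measurable_fading : ∀ i j, Measurable (N.fading i j)
  fading_law : ∀ i j, μ.map (N.fading i j) = expMeasure 1
  fading_indep : iIndepFun (fun p : ℕ × ℕ => N.fading p.1 p.2) μ
  measurable_tx : ∀ i, Measurable (N.tx i)
  measurable_rx : ∀ i, Measurable (N.rx i)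
  tx_ne_rx : ∀ i ω, N.tx i ω ≠ N.rx i ω
  indep_center : IndepFun (fun ω i => N.center i ω)
    (fun ω => ((fun i k => N.displacement i k ω), (fun i j => N.fading i j ω),
      (fun i => (N.tx i ω, N.rx i ω)))) μ
  indep_displacement : IndepFun (fun ω i k => N.displacement i k ω)
    (fun ω => ((fun i j => N.fading i j ω), (fun i => (N.tx i ω, N.rx i ω)))) μ
  indep_fading : IndepFun (fun ω i j => N.fading i j ω)
    (fun ω i => (N.tx i ω, N.rx i ω)) μ

/-- The position of the receiver of cluster `i`. -/
def receiver (N : D2DNetwork Ω n) (i : ℕ) (ω : Ω) : Plane :=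
  N.center i ω + N.displacement i (N.rx i ω) ω

/-- The center of cluster `j` in the coordinates whose origin is the receiver of cluster `i`. -/
def relCenter (N : D2DNetwork Ω n) (i j : ℕ) (ω : Ω) : Plane :=
  N.center j ω - N.receiver i ω

/-- The power that the receiver of cluster `i` receives from the transmitter of cluster `j`:
`Pd * g * ‖x + y‖ ^ (-α)`, with `x` the center of cluster `j` seen from that receiver, `y` the
displacement of the transmitter from `x`, and `g` the channel gain. -/
def power (N : D2DNetwork Ω n) (Pd α : ℝ) (i j : ℕ) (ω : Ω) : ℝ≥0∞ :=
  ENNReal.ofReal Pd * ENNReal.ofReal (N.fading i j ω) *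
    ‖N.relCenter i j ω + N.displacement j (N.tx j ω) ω‖ₑ ^ (-α)

/-- The inter-cluster interference at the receiver of cluster `i`. -/
def interference (N : D2DNetwork Ω n) (Pd α : ℝ) (i : ℕ) (ω : Ω) : ℝ≥0∞ :=
  ∑' j : {j : ℕ // j ≠ i}, N.power Pd α i j ω

/-- The signal-to-interference ratio at the receiver of cluster `i`. -/
def sir (N : D2DNetwork Ω n) (Pd α : ℝ) (i : ℕ) (ω : Ω) : ℝ≥0∞ :=
  N.power Pd α i i ω / N.interference Pd α i ω

/-- The probability that the typical receiver is covered, i.e. has a signal-to-interference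
ratio above `θ`, as a Palm probability computed in the window `B`: the mean number of covered
receivers in `B` divided by the mean number of receivers in `B`. -/
def coverageProb [MeasurableSpace Ω] (N : D2DNetwork Ω n) (μ : Measure Ω) (Pd α θ : ℝ)
    (B : Set Plane) : ℝ≥0∞ :=
  (∫⁻ ω, ∑' i, {ω' | N.receiver i ω' ∈ B ∧ ENNReal.ofReal θ < N.sir Pd α i ω'}.indicator
      (fun _ => 1) ω ∂μ) /
    (∫⁻ ω, ∑' i, {ω' | N.receiver i ω' ∈ B}.indicator (fun _ => 1) ω ∂μ)

end D2DNetwork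

/-- `𝒵(θ, α, σ) = π λ_p θ^(2/α) Γ(1 + 2/α) Γ(1 - 2/α) + 1 / (4 σ²)`. -/
def coverageZ (lam θ α σ : ℝ) : ℝ :=
  Real.pi * lam * θ ^ (2 / α) * Real.Gamma (1 + 2 / α) * Real.Gamma (1 - 2 / α) +
    1 / (4 * σ ^ 2)

end

open Filter Topology

/-! Rayleigh fading turns coverage into a Laplace transform. An exponential signal gain exceeds the
normalized interference `t` with probability `exp (-t)`. Averaging over the independent gains of the
interferers leaves a product of factors `(1 + s ‖v‖ ^ (-α))⁻¹`, one for each interferer at `v`,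
where `s = θ r ^ α` for a link of length `r` (`lt_sir_iff`, `measure_setOf_tsum_mul_lt`). Averaging
over the displacements of the other transmitters keeps the product form, now over the centers and
with factor `meanFadingFactor`.

The sum over receivers in `B` of such a product has mean `lam |B| exp (-lam ∫ (1 - factor))` by the
Slivnyak–Mecke formula (`mecke`). That formula comes from differentiating the Laplace functional
(`laplace`) in the direction of a weight on the distinguished point, and from an approximation that
lets the factor depend on this point.

By translation invariance the displacements drop out of the integral, which
`lintegral_one_sub_fadingFactor` evaluates to `s ^ (2/α) π Γ(1 + 2/α) Γ(1 - 2/α)`. As `s ^ (2/α) = θ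
^ (2/α) r ^ 2`, coverage given `r` has probability `exp (-c r ^ 2)`, and the Gaussian average
`lintegral_lintegral_exp_neg_mul_sq_dist` gives `1 / (1 + 4 σ² c)`. The mean number of receivers in
`B` is `lam |B|`, which cancels in the ratio.

Everything is computed in `[0, ∞]`, with products written as `expNeg` of a sum. The four sources of
randomness are separated by `lintegral_ingredients`. -/

/-! ### Exponential and logarithm on `[0, ∞]` -/

/-- The function `t ↦ exp (-t)` from `[0, ∞]` to `[0, 1]`. -/
noncomputable def expNeg (t : ℝ≥0∞) : ℝ≥0∞ := EReal.exp (-(t : EReal))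

theorem expNeg_zero : expNeg 0 = 1 := by simp [expNeg]

theorem expNeg_top : expNeg ∞ = 0 := by simp [expNeg]

theorem expNeg_ofReal {x : ℝ} (hx : 0 ≤ x) :
    expNeg (ENNReal.ofReal x) = ENNReal.ofReal (Real.exp (-x)) := by
  rw [expNeg, EReal.coe_ennreal_ofReal, max_eq_left hx, ← EReal.coe_neg, EReal.exp_coe]

theorem expNeg_of_ne_top {t : ℝ≥0∞} (ht : t ≠ ∞) :
    expNeg t = ENNReal.ofReal (Real.exp (-t.toReal)) := by
  conv_lhs => rw [← ENNReal.ofReal_toReal ht]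
  exact expNeg_ofReal ENNReal.toReal_nonneg

theorem expNeg_add (s t : ℝ≥0∞) : expNeg (s + t) = expNeg s * expNeg t := by
  by_cases hs : s = ∞
  · simp [hs, expNeg_top]
  by_cases ht : t = ∞
  · simp [ht, expNeg_top]
  rw [expNeg_of_ne_top hs, expNeg_of_ne_top ht, expNeg_of_ne_top (by simp [hs, ht]),
    ENNReal.toReal_add hs ht, neg_add, Real.exp_add, ENNReal.ofReal_mul (Real.exp_pos _).le]

theorem expNeg_antitone : Antitone expNeg := fun _ _ h =>
  EReal.exp_monotone (EReal.neg_le_neg_iff.2 (EReal.coe_ennreal_le_coe_ennreal_iff.2 h))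

theorem expNeg_le_one (t : ℝ≥0∞) : expNeg t ≤ 1 := by
  simpa [expNeg_zero] using expNeg_antitone (zero_le (a := t))

theorem expNeg_ne_top (t : ℝ≥0∞) : expNeg t ≠ ∞ :=
  ((expNeg_le_one t).trans_lt ENNReal.one_lt_top).ne

theorem exists_nnreal_expNeg (t : ℝ≥0∞) : ∃ q : ℝ≥0, q ≤ 1 ∧ (q : ℝ≥0∞) = expNeg t := by
  have h := ENNReal.coe_toNNReal (expNeg_ne_top t)
  refine ⟨_, ?_, h⟩
  rw [← ENNReal.coe_le_coe, h]
  exact expNeg_le_one t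

theorem expNeg_ne_zero {t : ℝ≥0∞} (ht : t ≠ ∞) : expNeg t ≠ 0 := by
  rw [expNeg_of_ne_top ht]
  simpa using Real.exp_pos _

theorem continuous_expNeg : Continuous expNeg :=
  ENNReal.continuous_exp.comp (continuous_neg.comp continuous_coe_ennreal_ereal)

theorem measurable_expNeg : Measurable expNeg := continuous_expNeg.measurable

theorem expNeg_sum {ι : Type*} (s : Finset ι) (f : ι → ℝ≥0∞) :
    expNeg (∑ i ∈ s, f i) = ∏ i ∈ s, expNeg (f i) := by
  classical
  induction s using Finset.induction_on with
  | empty => simp [expNeg_zero]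
  | insert a s ha ih => rw [Finset.sum_insert ha, Finset.prod_insert ha, expNeg_add, ih]

theorem expNeg_mul_natCast (t : ℝ≥0∞) (k : ℕ) : expNeg (t * k) = expNeg t ^ k := by
  rw [mul_comm, ← nsmul_eq_mul, ← Finset.card_range k, ← Finset.sum_const, expNeg_sum]
  simp

/-- The function `u ↦ -log u` from `[0, 1]` to `[0, ∞]`. -/
noncomputable def negLog (u : ℝ≥0∞) : ℝ≥0∞ := (ENNReal.log u⁻¹).toENNReal

/-- Allows a product of factors in `[0, 1]`, zero included, to be treated as `expNeg` of a sum, the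
shape that the Laplace functional handles. -/
theorem expNeg_negLog {u : ℝ≥0∞} (h : u ≤ 1) : expNeg (negLog u) = u := by
  rw [negLog, expNeg, EReal.coe_toENNReal (ENNReal.zero_le_log_iff.2 (ENNReal.one_le_inv.2 h)),
    ENNReal.log_inv, neg_neg, ENNReal.exp_log]

theorem negLog_ne_top {u : ℝ≥0∞} (h : u ≠ 0) : negLog u ≠ ∞ := by
  rw [negLog, Ne, EReal.toENNReal_eq_top_iff, ENNReal.log_eq_top_iff]
  simpa using h

theorem continuous_negLog : Continuous negLog :=
  EReal.continuous_toENNReal.comp (ENNReal.continuous_log.comp continuous_inv)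

theorem measurable_negLog : Measurable negLog := continuous_negLog.measurable

/-! ### Difference quotients of the exponential -/

/-- The difference quotient of `expNeg` at `0` with step `2⁻ⁿ`. -/
noncomputable def expQuot (n : ℕ) (t : ℝ≥0∞) : ℝ≥0∞ := 2 ^ n * (1 - expNeg ((2 ^ n)⁻¹ * t))

theorem two_pow_mul_inv (n : ℕ) : (2 ^ n : ℝ≥0∞) * (2 ^ n)⁻¹ = 1 :=
  ENNReal.mul_inv_cancel (by simp) (by simp)

theorem one_sub_expNeg_eq (n : ℕ) (t : ℝ≥0∞) :
    1 - expNeg ((2 ^ n)⁻¹ * t) = (2 ^ n)⁻¹ * expQuot n t := by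
  rw [expQuot, ← mul_assoc, mul_comm _ (2 ^ n : ℝ≥0∞), two_pow_mul_inv, one_mul]

theorem monotone_expQuot (n : ℕ) : Monotone (expQuot n) := fun _ _ h =>
  mul_le_mul_right (tsub_le_tsub_left (expNeg_antitone (mul_le_mul_right h _)) _) _

/-- Halving the step replaces `1 - q²` by `2 (1 - q)`, and the difference of the two is `(1 - q)²`.
Dyadic steps are chosen for this, so that derivatives can be taken by monotone convergence. -/
theorem monotone_expQuot_left (t : ℝ≥0∞) : Monotone fun n => expQuot n t := by
  refine monotone_nat_of_le_succ fun n => ?_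
  obtain ⟨q, hle', hq⟩ := exists_nnreal_expNeg ((2 ^ (n + 1))⁻¹ * t)
  have h1 : expNeg ((2 ^ n)⁻¹ * t) = q * q := by
    rw [hq, ← expNeg_add, ← two_mul, ← mul_assoc, pow_succ', ENNReal.mul_inv (by simp) (by simp),
      ← mul_assoc, ENNReal.mul_inv_cancel (by simp) (by simp), one_mul]
  rw [expQuot, expQuot, h1, ← hq, pow_succ, mul_assoc]
  refine mul_le_mul_right ?_ _
  norm_cast
  rw [← NNReal.coe_le_coe, NNReal.coe_sub (mul_le_one' hle' hle'), NNReal.coe_mul,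
    NNReal.coe_mul, NNReal.coe_sub hle']
  push_cast
  nlinarith [sq_nonneg (1 - (q : ℝ))]

theorem iSup_expQuot (t : ℝ≥0∞) : ⨆ n, expQuot n t = t := by
  have key : ∀ x : ℝ≥0, ⨆ n, expQuot n (x : ℝ≥0∞) = x := by
    intro x
    refine tendsto_nhds_unique (tendsto_atTop_iSup (monotone_expQuot_left _)) ?_
    have hd : HasDerivAt (fun s : ℝ => 1 - Real.exp (-(s * x))) x 0 := by
      have := ((((hasDerivAt_id (0 : ℝ)).mul_const (x : ℝ)).neg).exp).const_sub 1
      simpa using this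
    have h2 := hd.tendsto_slope_zero_right
    have h3 : Tendsto (fun n : ℕ => ((2 : ℝ) ^ n)⁻¹) atTop (𝓝[>] 0) := by
      refine tendsto_nhdsWithin_iff.2 ⟨?_, Eventually.of_forall fun n => ?_⟩
      · exact tendsto_inv_atTop_zero.comp (tendsto_pow_atTop_atTop_of_one_lt one_lt_two)
      · simp
    have h4 := ENNReal.tendsto_ofReal (h2.comp h3)
    rw [ENNReal.ofReal_coe_nnreal] at h4
    refine h4.congr fun n => ?_
    have e : ((2 ^ n)⁻¹ * (x : ℝ≥0∞)) = ENNReal.ofReal (((2 : ℝ) ^ n)⁻¹ * x) := by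
      rw [ENNReal.ofReal_mul (by positivity), ENNReal.ofReal_inv_of_pos (by positivity),
        ENNReal.ofReal_pow (by norm_num), ENNReal.ofReal_coe_nnreal]
      simp
    rw [expQuot, e, expNeg_ofReal (by positivity), ← ENNReal.ofReal_one,
      ← ENNReal.ofReal_sub _ (Real.exp_pos _).le]
    simp [ENNReal.ofReal_mul]
  by_cases ht : t = ∞
  · subst ht
    -- No derivative is available at `t = ∞`; monotonicity in `t` makes the supremum exceed every
    -- finite `r`.
    refine ENNReal.eq_top_of_forall_nnreal_le fun r => ?_
    rw [← key r]
    exact iSup_mono fun n => monotone_expQuot n le_top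
  · lift t to ℝ≥0 using ht
    exact key t

/-! ### Laplace functional of a Poisson process -/

/-- With `q = exp (-c)`, the mean of `q ^ k` is `exp (-m)` times the exponential series at `m q`. -/
theorem lintegral_expNeg_poissonMeasure (m : ℝ≥0) (c : ℝ≥0∞) :
    ∫⁻ k : ℕ, expNeg (c * k) ∂(poissonMeasure m) = expNeg (m * (1 - expNeg c)) := by
  obtain ⟨q, hq1, hq⟩ := exists_nnreal_expNeg c
  have hq' : expNeg c = ENNReal.ofReal q := by rw [ENNReal.ofReal_coe_nnreal]; exact hq.symm
  have h1 : (m : ℝ≥0∞) * (1 - expNeg c) = ENNReal.ofReal ((m : ℝ) * (1 - (q : ℝ))) := by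
    rw [ENNReal.ofReal_mul m.coe_nonneg, ENNReal.ofReal_coe_nnreal, ENNReal.ofReal_sub _ q.coe_nonneg,
      ENNReal.ofReal_one, hq']
  have hq2 : (q : ℝ) ≤ 1 := hq1
  rw [poissonMeasure, lintegral_sum_measure, h1,
    expNeg_ofReal (mul_nonneg m.coe_nonneg (sub_nonneg.2 hq2))]
  have hs : HasSum (fun n : ℕ => Real.exp (-m) * m ^ n / n.factorial * (q : ℝ) ^ n)
      (Real.exp (-(m * (1 - q)))) := by
    have := (NormedSpace.expSeries_div_hasSum_exp ((m : ℝ) * q)).mul_left (Real.exp (-m))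
    rw [← Real.exp_eq_exp_ℝ, ← Real.exp_add] at this
    rw [show -((m : ℝ) * (1 - q)) = -m + m * q by ring]
    refine (funext fun n => ?_ : (fun n : ℕ => _) = _) ▸ this
    rw [mul_pow]; ring
  rw [← hs.tsum_eq, ENNReal.ofReal_tsum_of_nonneg (fun n => by positivity) hs.summable]
  refine tsum_congr fun n => ?_
  rw [lintegral_smul_measure, lintegral_dirac, expNeg_mul_natCast, hq',
    ENNReal.ofReal_mul (by positivity), ENNReal.ofReal_pow q.coe_nonneg, smul_eq_mul]

section Poisson

variable {Ω : Type*} [MeasurableSpace Ω] {μ : Measure Ω} {lam : ℝ}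
  {X : ℕ → Ω → Plane}

theorem measurable_pointCount (hX : ∀ i, Measurable (X i)) {B : Set Plane}
    (hB : MeasurableSet B) : Measurable (pointCount X B) :=
  Measurable.tsum fun i => (measurable_const.indicator hB).comp (hX i)

namespace IsPoissonProcess

theorem lintegral_expNeg_pointCount (hX : IsPoissonProcess μ lam X) {B : Set Plane}
    (hB : MeasurableSet B) (hB' : volume B ≠ ∞) (c : ℝ≥0∞) :
    ∫⁻ ω, expNeg (c * pointCount X B ω) ∂μ =
      expNeg (ENNReal.ofReal lam * volume B * (1 - expNeg c)) := by
  have hm : Measurable fun t : ℝ≥0∞ => expNeg (c * t) :=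
    measurable_expNeg.comp (measurable_const.mul measurable_id)
  rw [← lintegral_map (f := fun t => expNeg (c * t)) hm (measurable_pointCount hX.measurable hB),
    hX.count_law B hB hB', lintegral_map hm (measurable_of_countable _),
    lintegral_expNeg_poissonMeasure,
    ENNReal.coe_toNNReal (ENNReal.mul_ne_top ENNReal.ofReal_ne_top hB')]

theorem lintegral_expNeg_sum (hX : IsPoissonProcess μ lam X) {m : ℕ} {B : Fin m → Set Plane}
    (hB : ∀ k, MeasurableSet (B k)) (hB' : ∀ k, volume (B k) ≠ ∞)
    (hd : Pairwise fun k l => Disjoint (B k) (B l)) (c : Fin m → ℝ≥0∞) :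
    ∫⁻ ω, expNeg (∑ k, c k * pointCount X (B k) ω) ∂μ =
      expNeg (ENNReal.ofReal lam * ∑ k, volume (B k) * (1 - expNeg (c k))) := by
  have hm : ∀ k, Measurable fun t : ℝ≥0∞ => expNeg (c k * t) := fun k =>
    measurable_expNeg.comp (measurable_const.mul measurable_id)
  have hi := (hX.count_indep m B hB hB' hd).comp _ hm
  simp_rw [expNeg_sum]
  have h := lintegral_prod_eq_prod_lintegral_of_indepFun Finset.univ _ hi
    (fun k => (hm k).comp (measurable_pointCount hX.measurable (hB k)))
  simp only [Function.comp_def] at h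
  rw [h, Finset.mul_sum, expNeg_sum]
  refine Finset.prod_congr rfl fun k _ => ?_
  rw [hX.lintegral_expNeg_pointCount (hB k) (hB' k), mul_assoc]

/-- The level sets of the nonzero values are disjoint and of finite area, so the sum over points is
a combination of independent Poisson counts. -/
theorem lintegral_expNeg_tsum_simpleFunc (hX : IsPoissonProcess μ lam X)
    (f : SimpleFunc Plane ℝ≥0∞) (hf : volume (Function.support f) ≠ ∞) :
    ∫⁻ ω, expNeg (∑' i, f (X i ω)) ∂μ =
      expNeg (ENNReal.ofReal lam * ∫⁻ x, (1 - expNeg (f x))) := by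
  classical
  set s := f.range.filter (· ≠ 0) with hs
  let e := s.equivFin.symm
  let B : Fin s.card → Set Plane := fun k => f ⁻¹' {(e k : ℝ≥0∞)}
  let c : Fin s.card → ℝ≥0∞ := fun k => e k
  have hB : ∀ k, MeasurableSet (B k) := fun k => f.measurableSet_preimage _
  -- Used with `g = id` on the points and with `g = 1 - expNeg` in the integral; the value `0` is
  -- left out of `s`, hence `g 0 = 0`.
  have hsum : ∀ (g : ℝ≥0∞ → ℝ≥0∞), g 0 = 0 → ∀ x,
      g (f x) = ∑ k, g (c k) * (B k).indicator (fun _ => 1) x := by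
    intro g hg x
    have e1 : ∑ k, g (c k) * (B k).indicator (fun _ => 1) x =
        ∑ y : s, g y * (f ⁻¹' {(y : ℝ≥0∞)}).indicator (fun _ => 1) x :=
      Fintype.sum_equiv e _ _ fun k => rfl
    rw [e1, Finset.sum_coe_sort s (fun y => g y * (f ⁻¹' {y}).indicator (fun _ => 1) x)]
    by_cases hx : f x = 0
    · rw [hx, hg, eq_comm]
      refine Finset.sum_eq_zero fun y hy => ?_
      have hy0 : y ≠ 0 := (Finset.mem_filter.1 hy).2
      rw [Set.indicator_of_notMem, mul_zero]
      simp [hx, hy0.symm]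
    · rw [Finset.sum_eq_single (f x)]
      · simp
      · intro y _ hy
        rw [Set.indicator_of_notMem, mul_zero]
        simpa using hy.symm
      · intro h
        exact absurd (Finset.mem_filter.2 ⟨SimpleFunc.mem_range_self f x, hx⟩) h
  have hB' : ∀ k, volume (B k) ≠ ∞ := fun k => by
    refine measure_ne_top_of_subset (fun x hx => ?_) hf
    have hk : (e k : ℝ≥0∞) ≠ 0 := (Finset.mem_filter.1 (e k).2).2
    have hx' : f x = e k := hx
    simpa [hx'] using hk
  have hd : Pairwise fun k l => Disjoint (B k) (B l) := by
    intro k l hkl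
    refine Set.disjoint_left.2 fun x hx hx' => hkl (e.injective (Subtype.ext ?_))
    exact (show f x = e k from hx).symm.trans hx'
  have h1 : ∀ ω, ∑' i, f (X i ω) = ∑ k, c k * pointCount X (B k) ω := by
    intro ω
    simp_rw [pointCount, ← ENNReal.tsum_mul_left]
    rw [← Summable.tsum_finsetSum fun _ _ => ENNReal.summable]
    exact tsum_congr fun i => hsum id rfl _
  have h2 : ∫⁻ x, (1 - expNeg (f x)) = ∑ k, volume (B k) * (1 - expNeg (c k)) := by
    rw [lintegral_congr fun x => hsum (fun t => 1 - expNeg t) (by simp [expNeg_zero]) x,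
      lintegral_finsetSum _ fun k _ => (measurable_const.indicator (hB k)).const_mul _]
    refine Finset.sum_congr rfl fun k _ => ?_
    rw [lintegral_const_mul _ (measurable_const.indicator (hB k)),
      lintegral_indicator_const (hB k), one_mul, mul_comm]
  simp_rw [h1, h2]
  exact hX.lintegral_expNeg_sum hB hB' hd c

/-- The Laplace functional of a homogeneous Poisson point process. -/
theorem laplace [IsProbabilityMeasure μ] (hX : IsPoissonProcess μ lam X) {f : Plane → ℝ≥0∞} (hf : Measurable f) :
    ∫⁻ ω, expNeg (∑' i, f (X i ω)) ∂μ =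
      expNeg (ENNReal.ofReal lam * ∫⁻ x, (1 - expNeg (f x))) := by
  -- Cutting off to balls gives supports of finite area while the sequence still increases to `f`.
  let g : ℕ → SimpleFunc Plane ℝ≥0∞ := fun n =>
    (SimpleFunc.eapprox f n).restrict (Metric.ball 0 n)
  have hg : ∀ n x, g n x = (Metric.ball (0 : Plane) n).indicator (SimpleFunc.eapprox f n) x :=
    fun n x => SimpleFunc.restrict_apply _ Metric.isOpen_ball.measurableSet x
  have hmono : ∀ x, Monotone fun n => g n x := by
    intro x n m hnm
    simp only [hg]
    refine (Set.indicator_le_indicator_of_subset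
      (Metric.ball_subset_ball (Nat.cast_le.2 hnm)) (fun _ => zero_le) x).trans ?_
    exact Set.indicator_le_indicator (SimpleFunc.monotone_eapprox f hnm x)
  have hlim : ∀ x, Tendsto (fun n => g n x) atTop (𝓝 (f x)) := by
    intro x
    have h : Tendsto (fun n => SimpleFunc.eapprox f n x) atTop (𝓝 (f x)) := by
      rw [← SimpleFunc.iSup_eapprox_apply hf x]
      exact tendsto_atTop_iSup fun n m hnm => SimpleFunc.monotone_eapprox f hnm x
    refine h.congr' ?_
    obtain ⟨N, hN⟩ := exists_nat_gt ‖x‖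
    filter_upwards [eventually_ge_atTop N] with n hn
    rw [hg, Set.indicator_of_mem]
    simpa using hN.trans_le (Nat.cast_le.2 hn)
  have hsup : ∀ x, ⨆ n, g n x = f x := fun x =>
    tendsto_nhds_unique (tendsto_atTop_iSup (hmono x)) (hlim x)
  have key : ∀ n, ∫⁻ ω, expNeg (∑' i, g n (X i ω)) ∂μ =
      expNeg (ENNReal.ofReal lam * ∫⁻ x, (1 - expNeg (g n x))) := by
    refine fun n => hX.lintegral_expNeg_tsum_simpleFunc (g n) ?_
    refine measure_ne_top_of_subset (s := Metric.ball (0 : Plane) n) (fun x hx => ?_)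
      (measure_ball_lt_top (μ := volume)).ne
    by_contra h
    exact hx (by rw [hg, Set.indicator_of_notMem h])
  have hmeas : ∀ n, Measurable fun ω => ∑' i, g n (X i ω) := fun n =>
    Measurable.tsum fun i => (g n).measurable.comp (hX.measurable i)
  have htsum : ∀ ω, Tendsto (fun n => ∑' i, g n (X i ω)) atTop (𝓝 (∑' i, f (X i ω))) := by
    intro ω
    have h : ∑' i, f (X i ω) = ⨆ n, ∑' i, g n (X i ω) := by
      simp_rw [← hsup, ← lintegral_count]
      exact lintegral_iSup (fun n => measurable_of_countable _)
        fun n m hnm i => hmono (X i ω) hnm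
    rw [h]
    exact tendsto_atTop_iSup fun n m hnm => ENNReal.tsum_le_tsum fun i => hmono _ hnm
  refine tendsto_nhds_unique ((tendsto_lintegral_of_dominated_convergence (fun _ => 1)
    (fun n => measurable_expNeg.comp (hmeas n))
    (fun n => Eventually.of_forall fun ω => expNeg_le_one _) (by simp)
    (Eventually.of_forall fun ω => (continuous_expNeg.tendsto _).comp (htsum ω))).congr key) ?_
  refine (continuous_expNeg.tendsto _).comp (ENNReal.Tendsto.const_mul ?_
    (Or.inr ENNReal.ofReal_ne_top))
  refine lintegral_tendsto_of_tendsto_of_monotone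
    (fun n => (measurable_const.sub (measurable_expNeg.comp (g n).measurable)).aemeasurable)
    (Eventually.of_forall fun x n m hnm => tsub_le_tsub_left (expNeg_antitone (hmono x hnm)) _)
    (Eventually.of_forall fun x => ?_)
  exact ENNReal.Tendsto.sub tendsto_const_nhds ((continuous_expNeg.tendsto _).comp (hlim x))
    (Or.inl ENNReal.one_ne_top)

end IsPoissonProcess
end Poisson

/-! ### Slivnyak–Mecke formula for a fixed factor -/

theorem tsum_eq_add_tsum_ne (f : ℕ → ℝ≥0∞) (i : ℕ) :
    ∑' j, f j = f i + ∑' j : {j // j ≠ i}, f j := by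
  have h := Summable.tsum_add_tsum_compl (f := f) (s := {i}) ENNReal.summable ENNReal.summable
  rw [tsum_singleton] at h
  exact h.symm

/-- The quotient increases in both the index and the argument, so the diagonal is cofinal in the
double supremum. -/
theorem iSup_expQuot_diag {T : ℕ → ℝ≥0∞} (hT : Monotone T) :
    ⨆ n, expQuot n (T n) = ⨆ n, T n := by
  refine le_antisymm (iSup_mono fun n => ?_) (iSup_le fun m => ?_)
  · exact (le_iSup (fun k => expQuot k (T n)) n).trans (iSup_expQuot _).le
  · refine (iSup_expQuot (T m)).symm.le.trans (iSup_le fun n => le_iSup_of_le (max n m) ?_)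
    exact (monotone_expQuot_left _ (le_max_left n m)).trans
      (monotone_expQuot _ (hT (le_max_right n m)))

theorem measurable_expQuot (n : ℕ) : Measurable (expQuot n) :=
  (monotone_expQuot n).measurable

theorem measurable_mul_expNeg_tsum_ne {Ω : Type*} [MeasurableSpace Ω] {X : ℕ → Ω → Plane}
    (hX : ∀ i, Measurable (X i)) {a f : Plane → ℝ≥0∞} (ha : Measurable a) (hf : Measurable f)
    (i : ℕ) : Measurable fun ω => a (X i ω) * expNeg (∑' j : {j // j ≠ i}, f (X j ω)) :=
  (ha.comp (hX i)).mul (measurable_expNeg.comp (Measurable.tsum fun j => hf.comp (hX j)))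

namespace IsPoissonProcess

variable {Ω : Type*} [MeasurableSpace Ω] {μ : Measure Ω} [IsProbabilityMeasure μ] {lam : ℝ}
  {X : ℕ → Ω → Plane}

/-- This is the derivative at `ε = 0` of the Laplace functional of `f + ε g`, with sign reversed.
Along `ε = 2⁻ⁿ` both sides increase, so no integrability is required. -/
theorem lintegral_tsum_mul_expNeg (hX : IsPoissonProcess μ lam X) {f g : Plane → ℝ≥0∞}
    (hf : Measurable f) (hg : Measurable g) :
    ∫⁻ ω, expNeg (∑' i, f (X i ω)) * ∑' i, g (X i ω) ∂μ =
      expNeg (ENNReal.ofReal lam * ∫⁻ x, (1 - expNeg (f x))) *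
        (ENNReal.ofReal lam * ∫⁻ x, expNeg (f x) * g x) := by
  set E := expNeg (ENNReal.ofReal lam * ∫⁻ x, (1 - expNeg (f x))) with hE
  set F : Ω → ℝ≥0∞ := fun ω => ∑' i, f (X i ω) with hF
  set G : Ω → ℝ≥0∞ := fun ω => ∑' i, g (X i ω) with hG
  have hFm : Measurable F := Measurable.tsum fun i => hf.comp (hX.measurable i)
  have hGm : Measurable G := Measurable.tsum fun i => hg.comp (hX.measurable i)
  set T : ℕ → ℝ≥0∞ := fun n => ENNReal.ofReal lam * ∫⁻ x, expNeg (f x) * expQuot n (g x) with hT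
  have hqm : ∀ n, Measurable fun x => expNeg (f x) * expQuot n (g x) := fun n =>
    (measurable_expNeg.comp hf).mul ((measurable_expQuot n).comp hg)
  have key : ∀ n, ∫⁻ ω, expNeg (F ω) * expQuot n (G ω) ∂μ = E * expQuot n (T n) := by
    intro n
    have h1 : ∫⁻ ω, expNeg (F ω) * (1 - expNeg ((2 ^ n)⁻¹ * G ω)) ∂μ =
        E * (1 - expNeg ((2 ^ n)⁻¹ * T n)) := by
      have e1 : ∀ ω, expNeg (F ω) * (1 - expNeg ((2 ^ n)⁻¹ * G ω)) =
          expNeg (F ω) - expNeg (∑' i, (f (X i ω) + (2 ^ n)⁻¹ * g (X i ω))) := by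
        intro ω
        rw [ENNReal.tsum_add, ENNReal.tsum_mul_left, expNeg_add,
          ENNReal.mul_sub fun _ _ => expNeg_ne_top _, mul_one]
      have hfg : Measurable fun x => f x + (2 ^ n)⁻¹ * g x := hf.add (hg.const_mul _)
      rw [lintegral_congr e1, lintegral_sub, hX.laplace hf, hX.laplace hfg, ← hE,
        ENNReal.mul_sub fun _ _ => expNeg_ne_top _, mul_one]
      · congr 1
        -- The exponent splits into that of `f` alone and `ε` times the integrand of `T n`; the
        -- first part produces the factor `E`.
        have e2 : ∀ x, 1 - expNeg (f x + (2 ^ n)⁻¹ * g x) =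
            (1 - expNeg (f x)) + (2 ^ n)⁻¹ * (expNeg (f x) * expQuot n (g x)) := by
          intro x
          rw [mul_left_comm, ← one_sub_expNeg_eq, ENNReal.mul_sub fun _ _ => expNeg_ne_top _,
            mul_one, expNeg_add]
          exact (tsub_add_tsub_cancel (expNeg_le_one _)
            (mul_le_of_le_one_right' (expNeg_le_one _))).symm
        rw [lintegral_congr e2, lintegral_add_right _ ((hqm n).const_mul _), lintegral_const_mul _ (hqm n), mul_add, expNeg_add,
          ← hE, hT, mul_left_comm]
      · exact measurable_expNeg.comp (Measurable.tsum fun i => hfg.comp (hX.measurable i))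
      · exact ((lintegral_mono fun ω => expNeg_le_one _).trans_lt (by simp)).ne
      · exact Eventually.of_forall fun ω =>
          expNeg_antitone (ENNReal.tsum_le_tsum fun i => le_self_add)
    have h2 := congrArg (fun t => 2 ^ n * t) h1
    rw [expQuot, ← mul_left_comm, ← h2, ← lintegral_const_mul' _ _ (by simp)]
    exact lintegral_congr fun ω => by rw [expQuot, mul_left_comm]
  have hmono : ∀ t, Monotone fun n => expQuot n t := monotone_expQuot_left
  have h3 : ⨆ n, ∫⁻ ω, expNeg (F ω) * expQuot n (G ω) ∂μ = ∫⁻ ω, expNeg (F ω) * G ω ∂μ := by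
    rw [← lintegral_iSup]
    · simp_rw [← ENNReal.mul_iSup, iSup_expQuot]
    · exact fun n => (measurable_expNeg.comp hFm).mul ((measurable_expQuot n).comp hGm)
    · exact fun n m hnm ω => mul_le_mul_right (hmono _ hnm) _
  have h4 : ⨆ n, T n = ENNReal.ofReal lam * ∫⁻ x, expNeg (f x) * g x := by
    rw [hT, ← ENNReal.mul_iSup, ← lintegral_iSup hqm
      fun n m hnm x => mul_le_mul_right (hmono _ hnm) _]
    simp_rw [← ENNReal.mul_iSup, iSup_expQuot]
  rw [← h3, iSup_congr key, ← ENNReal.mul_iSup, iSup_expQuot_diag, h4]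
  exact fun n m hnm => mul_le_mul_right
    (lintegral_mono fun x => mul_le_mul_right (hmono _ hnm) _) _

/-- The Slivnyak–Mecke formula for a product functional of the other points. -/
theorem tsum_lintegral_indicator_mul_expNeg (hX : IsPoissonProcess μ lam X) {f : Plane → ℝ≥0∞}
    (hf : Measurable f) (hf' : ∀ x, f x ≠ ∞) {A : Set Plane} (hA : MeasurableSet A) :
    ∑' i, ∫⁻ ω, A.indicator 1 (X i ω) * expNeg (∑' j : {j // j ≠ i}, f (X j ω)) ∂μ =
      ENNReal.ofReal lam * volume A *
        expNeg (ENNReal.ofReal lam * ∫⁻ x, (1 - expNeg (f x))) := by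
  have hind : Measurable (A.indicator (1 : Plane → ℝ≥0∞)) := measurable_one.indicator hA
  have hcancel : ∀ x, expNeg (f x) * ((expNeg (f x))⁻¹ * A.indicator 1 x) = A.indicator 1 x := by
    intro x
    rw [← mul_assoc, ENNReal.mul_inv_cancel (expNeg_ne_zero (hf' x)) (expNeg_ne_top _), one_mul]
  -- The weight `exp (f x)` on `A` removes the factor of the distinguished point from the full
  -- product, leaving the product over `j ≠ i`. Finiteness of `f` is what makes this division
  -- legitimate.
  have h := hX.lintegral_tsum_mul_expNeg hf (g := fun x => (expNeg (f x))⁻¹ * A.indicator 1 x)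
    ((measurable_expNeg.comp hf).inv.mul hind)
  simp_rw [hcancel] at h
  rw [lintegral_indicator_one hA, mul_comm] at h
  rw [← h, ← lintegral_tsum]
  · refine lintegral_congr fun ω => ?_
    rw [← ENNReal.tsum_mul_left]
    refine tsum_congr fun i => ?_
    rw [tsum_eq_add_tsum_ne _ i, expNeg_add, mul_comm (expNeg (f (X i ω))), mul_assoc, hcancel,
      mul_comm]
  · exact fun i => (measurable_mul_expNeg_tsum_ne hX.measurable hind hf i).aemeasurable

theorem tsum_lintegral_indicator (hX : IsPoissonProcess μ lam X) {A : Set Plane}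
    (hA : MeasurableSet A) :
    ∑' i, ∫⁻ ω, A.indicator 1 (X i ω) ∂μ = ENNReal.ofReal lam * volume A := by
  simpa [expNeg_zero] using
    hX.tsum_lintegral_indicator_mul_expNeg (f := 0) measurable_zero (by simp) hA

/-- On each piece of `A` where `q` is constant the factor no longer depends on the distinguished
point, so the fixed-factor formula applies piece by piece. -/
theorem tsum_lintegral_indicator_mul_expNeg_of_countable (hX : IsPoissonProcess μ lam X)
    {ι : Type*} [Countable ι] [MeasurableSpace ι] [MeasurableSingletonClass ι]
    {q : Plane → ι} (hq : Measurable q) {F : ι → Plane → ℝ≥0∞} (hF : ∀ k, Measurable (F k))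
    (hF' : ∀ w x, F (q w) x ≠ ∞) {A : Set Plane} (hA : MeasurableSet A) :
    ∑' i, ∫⁻ ω, A.indicator 1 (X i ω) * expNeg (∑' j : {j // j ≠ i}, F (q (X i ω)) (X j ω)) ∂μ =
      ∫⁻ w in A, ENNReal.ofReal lam *
        expNeg (ENNReal.ofReal lam * ∫⁻ x, (1 - expNeg (F (q w) x))) := by
  have hAk : ∀ k, MeasurableSet (A ∩ q ⁻¹' {k}) := fun k =>
    hA.inter (hq (measurableSet_singleton k))
  have hsplit : ∀ (h : ι → ℝ≥0∞) (w : Plane),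
      A.indicator 1 w * h (q w) = ∑' k, (A ∩ q ⁻¹' {k}).indicator 1 w * h k := by
    intro h w
    rw [tsum_eq_single (q w)]
    · by_cases hw : w ∈ A <;> simp [hw]
    · intro k hk
      rw [Set.indicator_of_notMem, zero_mul]
      exact fun hw => hk hw.2.symm
  have hind : ∀ k, Measurable ((A ∩ q ⁻¹' {k}).indicator (1 : Plane → ℝ≥0∞)) := fun k =>
    measurable_one.indicator (hAk k)
  have hterm : ∀ k, ∑' i, ∫⁻ ω, (A ∩ q ⁻¹' {k}).indicator 1 (X i ω) *
      expNeg (∑' j : {j // j ≠ i}, F k (X j ω)) ∂μ = ∫⁻ w, (A ∩ q ⁻¹' {k}).indicator 1 w *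
        (ENNReal.ofReal lam * expNeg (ENNReal.ofReal lam * ∫⁻ x, (1 - expNeg (F k x)))) := by
    intro k
    -- Finiteness of `F k` is known only for values `k` that `q` attains; on an empty piece both
    -- sides vanish.
    rcases (A ∩ q ⁻¹' {k}).eq_empty_or_nonempty with h | ⟨w, hw⟩
    · simp [h]
    · have hw' : q w = k := hw.2
      rw [hX.tsum_lintegral_indicator_mul_expNeg (hF k) (fun x => hw' ▸ hF' w x) (hAk k),
        lintegral_mul_const _ (hind k), lintegral_indicator_one (hAk k), mul_comm _ (volume _),
        mul_assoc]
  have hR : ∫⁻ w in A, ENNReal.ofReal lam *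
      expNeg (ENNReal.ofReal lam * ∫⁻ x, (1 - expNeg (F (q w) x))) =
      ∫⁻ w, A.indicator 1 w * (ENNReal.ofReal lam *
      expNeg (ENNReal.ofReal lam * ∫⁻ x, (1 - expNeg (F (q w) x)))) := by
    rw [← lintegral_indicator hA]
    refine lintegral_congr fun w => ?_
    by_cases hw : w ∈ A <;> simp [hw]
  rw [hR, lintegral_congr fun w => hsplit (fun k => ENNReal.ofReal lam *
      expNeg (ENNReal.ofReal lam * ∫⁻ x, (1 - expNeg (F k x)))) w,
    lintegral_tsum fun k => ((hind k).mul_const _).aemeasurable, ← tsum_congr hterm,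
    ENNReal.tsum_comm]
  refine tsum_congr fun i => ?_
  rw [← lintegral_tsum fun k =>
    (measurable_mul_expNeg_tsum_ne hX.measurable (hind k) (hF k) i).aemeasurable]
  exact lintegral_congr fun ω =>
    hsplit (fun k => expNeg (∑' j : {j // j ≠ i}, F k (X j ω))) (X i ω)

end IsPoissonProcess

/-! ### Slivnyak–Mecke formula for a factor depending on the point -/

/-- A jointly continuous function is an increasing limit of functions that depend on the first
variable only through a finite partition. -/
theorem exists_monotone_tendsto_of_continuous {E S : Type*} [TopologicalSpace E]
    [SecondCountableTopology E] [Nonempty E] [MeasurableSpace E] [OpensMeasurableSpace E]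
    [TopologicalSpace S] [MeasurableSpace S] [OpensMeasurableSpace S] {f : E → S → ℝ≥0∞}
    (hf : Continuous (Function.uncurry f)) :
    ∃ (q : (n : ℕ) → E → Fin n → Prop) (F : (n : ℕ) → (Fin n → Prop) → S → ℝ≥0∞),
      (∀ n, Measurable (q n)) ∧ (∀ n k, Measurable (F n k)) ∧
      (∀ w x, Monotone fun n => F n (q n w) x) ∧
      ∀ w x, Tendsto (fun n => F n (q n w) x) atTop (𝓝 (f w x)) := by
  obtain ⟨s, hs, -, hbasis⟩ := TopologicalSpace.exists_countable_basis E
  have hne : s.Nonempty := by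
    obtain ⟨w⟩ := ‹Nonempty E›
    obtain ⟨u, hu, -⟩ := hbasis.exists_subset_of_mem_open (Set.mem_univ w) isOpen_univ
    exact ⟨u, hu⟩
  obtain ⟨b, rfl⟩ := hs.exists_eq_range hne
  let q : (n : ℕ) → E → Fin n → Prop := fun n w k => w ∈ b k
  -- A cell consists of the points lying in the same sets among the first `n` basic open sets. Cells
  -- shrink with `n`, so the infima over them increase.
  let F : (n : ℕ) → (Fin n → Prop) → S → ℝ≥0∞ := fun n k x => ⨅ w : {w // q n w = k}, f w x
  have hle : ∀ n w x, F n (q n w) x ≤ f w x := fun n w x => iInf_le_of_le ⟨w, rfl⟩ le_rfl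
  have hmono : ∀ w x, Monotone fun n => F n (q n w) x := by
    intro w x n m hnm
    refine le_iInf fun w' => iInf_le_of_le ⟨w', ?_⟩ le_rfl
    funext k
    exact congrFun w'.2 (Fin.castLE hnm k)
  refine ⟨q, F, fun n => ?_, fun n k => ?_, hmono, fun w x => ?_⟩
  · refine measurable_pi_iff.2 fun k => measurableSet_setOfPred.1 ?_
    exact (hbasis.isOpen (Set.mem_range_self (k : ℕ))).measurableSet
  -- The infimum may be uncountable; it is measurable because an infimum of continuous functions is
  -- upper semicontinuous.
  · have hw : ∀ w : {w // q n w = k}, UpperSemicontinuous fun x => f w x := fun w =>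
      (hf.comp (Continuous.prodMk_right (w : E))).upperSemicontinuous
    exact (upperSemicontinuous_iInf hw).measurable
  -- The open set where `f · x` exceeds `t'` contains a basic neighbourhood `b k` of `w`, and for `n
  -- > k` the whole cell of `w` lies in `b k`.
  · refine tendsto_order.2 ⟨fun t ht => ?_, fun t ht =>
      Eventually.of_forall fun n => (hle n w x).trans_lt ht⟩
    obtain ⟨t', htt', ht'⟩ := exists_between ht
    have ho : IsOpen {w' | t' < f w' x} :=
      isOpen_lt continuous_const (hf.comp (Continuous.prodMk_left x))
    obtain ⟨_, ⟨k, rfl⟩, hwk, hk⟩ := hbasis.exists_subset_of_mem_open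
      (show w ∈ {w' | t' < f w' x} from ht') ho
    filter_upwards [eventually_gt_atTop k] with n hn
    refine htt'.trans_le (le_iInf fun w' => (hk ?_ : t' < f w' x).le)
    have := congrFun w'.2 ⟨k, hn⟩
    exact this.mpr hwk

theorem ENNReal.tendsto_tsum_of_monotone {ι : Type*} [Countable ι] {f : ℕ → ι → ℝ≥0∞}
    {g : ι → ℝ≥0∞} (hf : ∀ i, Monotone fun n => f n i)
    (hg : ∀ i, Tendsto (fun n => f n i) atTop (𝓝 (g i))) :
    Tendsto (fun n => ∑' i, f n i) atTop (𝓝 (∑' i, g i)) := by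
  let _ : MeasurableSpace ι := ⊤
  simp_rw [← lintegral_count]
  exact lintegral_tendsto_of_tendsto_of_monotone (fun n => (measurable_of_countable _).aemeasurable)
    (Eventually.of_forall hf) (Eventually.of_forall hg)

namespace IsPoissonProcess

variable {Ω : Type*} [MeasurableSpace Ω] {μ : Measure Ω} [IsProbabilityMeasure μ] {lam : ℝ}
  {X : ℕ → Ω → Plane}

/-- The Slivnyak–Mecke formula for a product functional seen from the points in a set. -/
theorem mecke (hX : IsPoissonProcess μ lam X) {f : Plane → Plane → ℝ≥0∞}
    (hf : Continuous (Function.uncurry f)) (hf' : ∀ w x, f w x ≠ ∞) {A : Set Plane}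
    (hA : MeasurableSet A) (hA' : volume A ≠ ∞) :
    ∑' i, ∫⁻ ω, A.indicator 1 (X i ω) * expNeg (∑' j : {j // j ≠ i}, f (X i ω) (X j ω)) ∂μ =
      ∫⁻ w in A, ENNReal.ofReal lam *
        expNeg (ENNReal.ofReal lam * ∫⁻ x, (1 - expNeg (f w x))) := by
  obtain ⟨q, F, hq, hF, hmono, hlim⟩ := exists_monotone_tendsto_of_continuous hf
  have hle : ∀ n w x, F n (q n w) x ≤ f w x := fun n w x => (hmono w x).ge_of_tendsto (hlim w x) n
  have key : ∀ n, ∑' i, ∫⁻ ω, A.indicator 1 (X i ω) *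
      expNeg (∑' j : {j // j ≠ i}, F n (q n (X i ω)) (X j ω)) ∂μ =
      ∫⁻ w in A, ENNReal.ofReal lam *
        expNeg (ENNReal.ofReal lam * ∫⁻ x, (1 - expNeg (F n (q n w) x))) := fun n =>
    hX.tsum_lintegral_indicator_mul_expNeg_of_countable (hq n) (hF n)
      (fun w x => ne_top_of_le_ne_top (hf' w x) (hle n w x)) hA
  have hind : Measurable (A.indicator (1 : Plane → ℝ≥0∞)) := measurable_one.indicator hA
  have hindle : ∀ w (t : ℝ≥0∞), A.indicator 1 w * expNeg t ≤ A.indicator (1 : Plane → ℝ≥0∞) w :=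
    fun w t => mul_le_of_le_one_right' (expNeg_le_one t)
  have hbound : ∑' i, ∫⁻ ω, A.indicator 1 (X i ω) ∂μ ≠ ∞ := by
    rw [hX.tsum_lintegral_indicator hA]
    exact ENNReal.mul_ne_top ENNReal.ofReal_ne_top hA'
  have hterm : ∀ i, ∫⁻ ω, A.indicator 1 (X i ω) ∂μ ≠ ∞ := ENNReal.ne_top_of_tsum_ne_top hbound
  have hFm : ∀ n, Measurable fun p : Plane × Plane => F n (q n p.1) p.2 := fun n =>
    (measurable_from_prod_countable_right (f := fun p : (Fin n → Prop) × Plane => F n p.1 p.2)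
      (hF n)).comp (((hq n).comp measurable_fst).prodMk measurable_snd)
  have hL : Tendsto (fun n => ∑' i, ∫⁻ ω, A.indicator 1 (X i ω) *
      expNeg (∑' j : {j // j ≠ i}, F n (q n (X i ω)) (X j ω)) ∂μ) atTop
      (𝓝 (∑' i, ∫⁻ ω, A.indicator 1 (X i ω) *
        expNeg (∑' j : {j // j ≠ i}, f (X i ω) (X j ω)) ∂μ)) := by
    have hin : ∀ i, Tendsto (fun n => ∫⁻ ω, A.indicator 1 (X i ω) *
        expNeg (∑' j : {j // j ≠ i}, F n (q n (X i ω)) (X j ω)) ∂μ) atTop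
        (𝓝 (∫⁻ ω, A.indicator 1 (X i ω) *
          expNeg (∑' j : {j // j ≠ i}, f (X i ω) (X j ω)) ∂μ)) := by
      intro i
      refine tendsto_lintegral_of_dominated_convergence (fun ω => A.indicator 1 (X i ω))
        (fun n => ?_) (fun n => Eventually.of_forall fun ω => hindle _ _) (hterm i)
        (Eventually.of_forall fun ω => ?_)
      · exact (hind.comp (hX.measurable i)).mul (measurable_expNeg.comp (Measurable.tsum fun j =>
          (hFm n).comp ((hX.measurable i).prodMk (hX.measurable j))))
      · refine ENNReal.Tendsto.const_mul ((continuous_expNeg.tendsto _).comp ?_)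
          (Or.inr (by by_cases h : X i ω ∈ A <;> simp [h]))
        exact ENNReal.tendsto_tsum_of_monotone (fun j => hmono _ _) (fun j => hlim _ _)
    -- Dominated convergence a second time, now for the sum over `i`; the bound is the finite mean
    -- number of points in `A`.
    have h := tendsto_lintegral_of_dominated_convergence (μ := Measure.count)
      (fun i => ∫⁻ ω, A.indicator 1 (X i ω) ∂μ) (fun n => measurable_of_countable _)
      (fun n => Eventually.of_forall fun i => lintegral_mono fun ω => hindle _ _)
      (by rwa [lintegral_count]) (Eventually.of_forall hin)
    simpa only [lintegral_count] using h
  refine tendsto_nhds_unique (hL.congr key) ?_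
  refine tendsto_lintegral_of_dominated_convergence (fun _ => ENNReal.ofReal lam)
    (fun n => ?_) (fun n => Eventually.of_forall fun w => mul_le_of_le_one_right' (expNeg_le_one _))
    ?_ (Eventually.of_forall fun w => ?_)
  · exact measurable_const.mul (measurable_expNeg.comp (measurable_const.mul
      (measurable_const.sub (measurable_expNeg.comp (hFm n))).lintegral_prod_right'))
  · simpa using ENNReal.mul_ne_top ENNReal.ofReal_ne_top hA'
  · refine ENNReal.Tendsto.const_mul ((continuous_expNeg.tendsto _).comp
      (ENNReal.Tendsto.const_mul ?_ (Or.inr ENNReal.ofReal_ne_top))) (Or.inr ENNReal.ofReal_ne_top)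
    refine lintegral_tendsto_of_tendsto_of_monotone (fun n => (measurable_const.sub
      (measurable_expNeg.comp ((hFm n).comp measurable_prodMk_left))).aemeasurable)
      (Eventually.of_forall fun x n m hnm => tsub_le_tsub_left (expNeg_antitone (hmono w x hnm)) _)
      (Eventually.of_forall fun x => ?_)
    exact ENNReal.Tendsto.sub tendsto_const_nhds ((continuous_expNeg.tendsto _).comp (hlim w x))
      (Or.inl ENNReal.one_ne_top)

end IsPoissonProcess

/-! ### The exponential law -/

theorem expMeasure_one_setOf_lt_ofReal (t : ℝ≥0∞) :
    expMeasure 1 {x | t < ENNReal.ofReal x} = expNeg t := by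
  have : IsProbabilityMeasure (expMeasure 1) := isProbabilityMeasure_expMeasure one_pos
  by_cases ht : t = ∞
  · simp [ht, expNeg_top]
  have hset : {x | t < ENNReal.ofReal x} = (Set.Iic t.toReal)ᶜ := by
    ext x
    simp [ENNReal.lt_ofReal_iff_toReal_lt ht]
  rw [hset, prob_compl_eq_one_sub measurableSet_Iic, ← ofReal_cdf, cdf_expMeasure_eq one_pos,
    if_pos ENNReal.toReal_nonneg, one_mul, ← ENNReal.ofReal_one,
    ← ENNReal.ofReal_sub _ (sub_nonneg.2 (Real.exp_le_one_iff.2 (by simp))), sub_sub_cancel,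
    expNeg_of_ne_top ht]

theorem lintegral_expMeasure_one {f : ℝ → ℝ≥0∞} (hf : Measurable f) :
    ∫⁻ x, f x ∂(expMeasure 1) = ∫⁻ x, exponentialPDF 1 x * f x := by
  have hm : Measurable (exponentialPDF 1) :=
    ENNReal.measurable_ofReal.comp (measurable_exponentialPDFReal 1)
  exact lintegral_withDensity_eq_lintegral_mul _ hm hf

theorem measurable_expNeg_mul_ofReal (a : ℝ≥0∞) :
    Measurable fun x : ℝ => expNeg (a * ENNReal.ofReal x) :=
  measurable_expNeg.comp (measurable_const.mul ENNReal.measurable_ofReal)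

/-- The Laplace transform of the exponential law of mean one. -/
theorem lintegral_expNeg_expMeasure_one (a : ℝ≥0∞) :
    ∫⁻ x, expNeg (a * ENNReal.ofReal x) ∂(expMeasure 1) = (1 + a)⁻¹ := by
  rw [lintegral_expMeasure_one (measurable_expNeg_mul_ofReal a)]
  by_cases ha : a = ∞
  · subst ha
    rw [add_top, ENNReal.inv_top, lintegral_eq_zero_iff' (by
      refine (Measurable.mul ?_ (measurable_expNeg_mul_ofReal ∞)).aemeasurable
      exact ENNReal.measurable_ofReal.comp (measurable_exponentialPDFReal 1))]
    -- Since `∞ * 0 = 0`, the integrand does not vanish at `x = 0`, a null set.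
    filter_upwards [volume.ae_ne 0] with x hx
    rcases lt_or_gt_of_ne hx with h | h
    · simp [exponentialPDF_of_neg h]
    · rw [ENNReal.top_mul (by simpa using h), expNeg_top]
      simp
  have hc : 0 ≤ a.toReal := ENNReal.toReal_nonneg
  have hpos : 0 < 1 + a.toReal := by linarith
  -- Exponential tilting: the integrand is a multiple of the density of rate `1 + a`, which has
  -- total mass one.
  have hpt : ∀ x, exponentialPDF 1 x * expNeg (a * ENNReal.ofReal x) =
      ENNReal.ofReal (1 + a.toReal)⁻¹ * exponentialPDF (1 + a.toReal) x := by
    intro x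
    rcases lt_or_ge x 0 with h | h
    · simp [exponentialPDF_of_neg h]
    · rw [exponentialPDF_of_nonneg h, exponentialPDF_of_nonneg h, ← ENNReal.ofReal_toReal ha,
        ← ENNReal.ofReal_mul hc, expNeg_ofReal (by positivity), ← ENNReal.ofReal_mul (by positivity),
        ← ENNReal.ofReal_mul (by positivity), ENNReal.toReal_ofReal hc, ← mul_assoc,
        inv_mul_cancel₀ hpos.ne', one_mul, one_mul, one_mul, ← Real.exp_add]
      congr 2
      ring
  rw [lintegral_congr hpt, lintegral_const_mul' _ _ ENNReal.ofReal_ne_top,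
    lintegral_exponentialPDF_eq_one hpos, mul_one, ENNReal.ofReal_inv_of_pos hpos,
    ENNReal.ofReal_add zero_le_one hc, ENNReal.ofReal_one, ENNReal.ofReal_toReal ha]

/-! ### Independence and Rayleigh fading -/

section Independence

variable {Ω : Type*} [MeasurableSpace Ω] {μ : Measure Ω} [IsProbabilityMeasure μ]

theorem ProbabilityTheory.IndepFun.lintegral_eq_lintegral_lintegral {α β : Type*}
    [MeasurableSpace α] [MeasurableSpace β] {U : Ω → α} {V : Ω → β} (h : IndepFun U V μ)
    (hU : Measurable U) (hV : Measurable V) {Φ : α → β → ℝ≥0∞}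
    (hΦ : Measurable (Function.uncurry Φ)) :
    ∫⁻ ω, Φ (U ω) (V ω) ∂μ = ∫⁻ ω, ∫⁻ ω', Φ (U ω) (V ω') ∂μ ∂μ := by
  have h1 : ∫⁻ ω, Φ (U ω) (V ω) ∂μ = ∫⁻ p, Function.uncurry Φ p ∂(μ.map fun ω => (U ω, V ω)) :=
    (lintegral_map hΦ (hU.prodMk hV)).symm
  have : IsProbabilityMeasure (μ.map U) := Measure.isProbabilityMeasure_map hU.aemeasurable
  have : IsProbabilityMeasure (μ.map V) := Measure.isProbabilityMeasure_map hV.aemeasurable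
  rw [h1, (indepFun_iff_map_prod_eq_prod_map_map hU.aemeasurable hV.aemeasurable).1 h,
    lintegral_prod _ hΦ.aemeasurable, lintegral_map hΦ.lintegral_prod_right' hU]
  exact lintegral_congr fun ω => lintegral_map (hΦ.comp measurable_prodMk_left) hV

/-- Finite subfamilies factor by independence, and the bound `expNeg ≤ 1` carries the identity to
the limit along finite sets. -/
theorem ProbabilityTheory.iIndepFun.lintegral_expNeg_tsum {ι : Type*} [Countable ι]
    {H : ι → Ω → ℝ≥0∞} (hH : iIndepFun H μ) (hm : ∀ j, Measurable (H j)) {ψ : ι → ℝ≥0∞}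
    (hψ : ∀ j, ∫⁻ ω, expNeg (H j ω) ∂μ = expNeg (ψ j)) :
    ∫⁻ ω, expNeg (∑' j, H j ω) ∂μ = expNeg (∑' j, ψ j) := by
  have hfin : ∀ s : Finset ι, ∫⁻ ω, expNeg (∑ j ∈ s, H j ω) ∂μ = expNeg (∑ j ∈ s, ψ j) := by
    intro s
    simp_rw [expNeg_sum, ← hψ]
    exact lintegral_prod_eq_prod_lintegral_of_indepFun s _
      (hH.comp (fun _ => expNeg) fun _ => measurable_expNeg) fun j => measurable_expNeg.comp (hm j)
  have hlim : ∀ f : ι → ℝ≥0∞, Tendsto (fun s : Finset ι => expNeg (∑ j ∈ s, f j)) atTop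
      (𝓝 (expNeg (∑' j, f j))) := fun f =>
    (continuous_expNeg.tendsto _).comp ENNReal.summable.hasSum
  refine tendsto_nhds_unique (f := fun s : Finset ι => ∫⁻ ω, expNeg (∑ j ∈ s, H j ω) ∂μ) ?_
    ((hlim ψ).congr fun s => (hfin s).symm)
  exact tendsto_lintegral_filter_of_dominated_convergence (fun _ => 1)
    (Eventually.of_forall fun s => measurable_expNeg.comp (Finset.measurable_sum s fun j _ => hm j))
    (Eventually.of_forall fun s => Eventually.of_forall fun ω => expNeg_le_one _) (by simp)
    (Eventually.of_forall fun ω => hlim _)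

theorem ProbabilityTheory.iIndepFun.indepFun_restrict {ι S T : Type*} {β : ι → Type*}
    [∀ i, MeasurableSpace (β i)] {Y : ∀ i, Ω → β i} (hY : iIndepFun Y μ)
    (hm : ∀ i, Measurable (Y i)) {a : S → ι} {b : T → ι} (hab : ∀ s t, a s ≠ b t) :
    IndepFun (fun ω s => Y (a s) ω) (fun ω t => Y (b t) ω) μ := by
  classical
  refine IndepFun.process_indepFun_process (fun s => hm _) (fun t => hm _) fun I J => ?_
  have hd : Disjoint (I.image a) (J.image b) := by
    rw [Finset.disjoint_left]
    intro i hi hi'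
    obtain ⟨s, -, rfl⟩ := Finset.mem_image.1 hi
    obtain ⟨t, -, ht⟩ := Finset.mem_image.1 hi'
    exact hab s t ht.symm
  have h := hY.indepFun_finset _ _ hd hm
  exact h.comp
    (φ := fun (z : ∀ i : (I.image a : Finset ι), β i) (s : I) =>
      z ⟨a s, Finset.mem_image_of_mem a s.2⟩)
    (ψ := fun (z : ∀ i : (J.image b : Finset ι), β i) (t : J) =>
      z ⟨b t, Finset.mem_image_of_mem b t.2⟩)
    (measurable_pi_lambda _ fun s => measurable_pi_apply _)
    (measurable_pi_lambda _ fun t => measurable_pi_apply _)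

/-- Coverage probability under Rayleigh fading, given the path losses. -/
theorem measure_setOf_tsum_mul_lt {g : ℕ → Ω → ℝ} (hg : iIndepFun g μ)
    (hm : ∀ j, Measurable (g j)) (hlaw : ∀ j, μ.map (g j) = expMeasure 1) (i : ℕ)
    (a : ℕ → ℝ≥0∞) :
    ∫⁻ ω, {ω | ∑' j : {j // j ≠ i}, a j * ENNReal.ofReal (g j ω) < ENNReal.ofReal (g i ω)}.indicator
      1 ω ∂μ = expNeg (∑' j : {j // j ≠ i}, negLog (1 + a j)⁻¹) := by
  have hi := hg.indepFun_restrict hm (a := fun _ : Unit => i)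
    (b := fun j : {j // j ≠ i} => (j : ℕ)) fun _ j => j.2.symm
  let Φ : ({j // j ≠ i} → ℝ) → (Unit → ℝ) → ℝ≥0∞ := fun v u =>
    {p : ({j // j ≠ i} → ℝ) × (Unit → ℝ) | ∑' j : {j // j ≠ i}, a j * ENNReal.ofReal (p.1 j) <
      ENNReal.ofReal (p.2 ())}.indicator 1 (v, u)
  have hsm : Measurable fun v : {j // j ≠ i} → ℝ =>
      ∑' j : {j // j ≠ i}, a j * ENNReal.ofReal (v j) :=
    Measurable.tsum fun j => (ENNReal.measurable_ofReal.comp (measurable_pi_apply j)).const_mul _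
  have hΦ : Measurable (Function.uncurry Φ) := by
    refine measurable_one.indicator (measurableSet_lt (hsm.comp measurable_fst) ?_)
    exact ENNReal.measurable_ofReal.comp ((measurable_pi_apply ()).comp measurable_snd)
  have h := hi.symm.lintegral_eq_lintegral_lintegral
    (measurable_pi_lambda _ fun j => hm _) (measurable_pi_lambda _ fun _ => hm _) hΦ
  refine h.trans ?_
  -- Given the interfering gains, the probability is the exponential tail at the interference level.
  have hin : ∀ v : {j // j ≠ i} → ℝ, ∫⁻ ω', Φ v (fun _ => g i ω') ∂μ =
      expNeg (∑' j : {j // j ≠ i}, a j * ENNReal.ofReal (v j)) := by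
    intro v
    have hs : MeasurableSet {x : ℝ | ∑' j : {j // j ≠ i}, a j * ENNReal.ofReal (v j) <
        ENNReal.ofReal x} := measurableSet_lt measurable_const ENNReal.measurable_ofReal
    rw [← expMeasure_one_setOf_lt_ofReal, ← hlaw i, ← lintegral_indicator_one hs,
      lintegral_map (measurable_one.indicator hs) (hm i)]
    rfl
  rw [lintegral_congr fun ω => hin _]
  refine ((hg.precomp (g := fun j : {j // j ≠ i} => (j : ℕ)) Subtype.val_injective).comp
    (fun j x => a j * ENNReal.ofReal x) fun j =>
      ENNReal.measurable_ofReal.const_mul _).lintegral_expNeg_tsum (fun j =>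
      (ENNReal.measurable_ofReal.const_mul _).comp (hm j)) fun j => ?_
  rw [expNeg_negLog (ENNReal.inv_le_one.2 le_self_add), ← lintegral_expNeg_expMeasure_one,
    ← hlaw j, lintegral_map (measurable_expNeg_mul_ofReal _) (hm j)]
  rfl

end Independence

/-! ### The interference integral over the plane -/

theorem lintegral_one_sub_of_le_one {S : Type*} [MeasurableSpace S] {ν : Measure S}
    [IsProbabilityMeasure ν] {f : S → ℝ≥0∞} (hf : Measurable f) (hf1 : ∀ x, f x ≤ 1) :
    ∫⁻ x, (1 - f x) ∂ν = 1 - ∫⁻ x, f x ∂ν := by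
  have h1 : ∫⁻ x, f x ∂ν ≠ ∞ := ((lintegral_mono hf1).trans_lt (by simp)).ne
  rw [lintegral_sub hf h1 (Eventually.of_forall hf1), lintegral_const, measure_univ, mul_one]

/-- Used at `p = 2/α` and at `p = -2/α`; the second is integrable exactly because `α > 2`. -/
theorem lintegral_rpow_expMeasure_one {p : ℝ} (hp : -1 < p) :
    ∫⁻ x, ENNReal.ofReal x ^ p ∂(expMeasure 1) = ENNReal.ofReal (Real.Gamma (1 + p)) := by
  have hp' : 0 < 1 + p := by linarith
  rw [lintegral_expMeasure_one (ENNReal.measurable_ofReal.pow_const p),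
    Real.Gamma_eq_integral hp', ofReal_integral_eq_lintegral_ofReal
      (Real.GammaIntegral_convergent hp')
      ((ae_restrict_iff' measurableSet_Ioi).2 (Eventually.of_forall fun x hx =>
        mul_nonneg (Real.exp_pos _).le (Real.rpow_nonneg (le_of_lt hx) _))),
    ← lintegral_indicator measurableSet_Ioi]
  refine lintegral_congr_ae ?_
  filter_upwards [volume.ae_ne 0] with x hx
  rcases lt_or_gt_of_ne hx with h | h
  · rw [exponentialPDF_of_neg h, zero_mul, Set.indicator_of_notMem]
    simpa using h.le
  · rw [exponentialPDF_of_nonneg h.le, Set.indicator_of_mem (Set.mem_Ioi.2 h), one_mul, one_mul,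
      ENNReal.ofReal_mul (Real.exp_pos _).le, ENNReal.ofReal_rpow_of_pos h, add_sub_cancel_left]

theorem volume_setOf_enorm_le {R : ℝ≥0∞} (hR : R ≠ ∞) :
    volume {v : Plane | ‖v‖ₑ ≤ R} = R ^ 2 * ENNReal.ofReal Real.pi := by
  have h : {v : Plane | ‖v‖ₑ ≤ R} = Metric.closedBall 0 R.toReal := by
    ext v
    rw [Set.mem_ofPred_eq, mem_closedBall_zero_iff, ← ofReal_norm,
      ENNReal.ofReal_le_iff_le_toReal hR]
  rw [h, EuclideanSpace.volume_closedBall_fin_two, ENNReal.ofReal_toReal hR]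

/-- The set is the disc of radius `(c / x) ^ (1/α)`. -/
theorem volume_setOf_le_mul_enorm_rpow {α : ℝ} (hα : 0 < α) {x c : ℝ≥0∞} (hx : x ≠ 0)
    (hx' : x ≠ ∞) (hc : c ≠ 0) (hc' : c ≠ ∞) :
    volume {v : Plane | x ≤ c * ‖v‖ₑ ^ (-α)} =
      c ^ (2 / α) * x ^ (-(2 / α)) * ENNReal.ofReal Real.pi := by
  have h : ∀ v : Plane, x ≤ c * ‖v‖ₑ ^ (-α) ↔ ‖v‖ₑ ≤ (c / x) ^ α⁻¹ := by
    intro v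
    rw [ENNReal.rpow_neg, ← div_eq_mul_inv, ENNReal.le_div_iff_mul_le (Or.inr hc) (Or.inr hc'),
      mul_comm, ← ENNReal.le_div_iff_mul_le (Or.inl hx) (Or.inl hx'),
      ENNReal.le_rpow_inv_iff hα]
  have hR : (c / x) ^ α⁻¹ ≠ ∞ :=
    ENNReal.rpow_ne_top_of_nonneg (inv_nonneg.2 hα.le) (ENNReal.div_ne_top hc' hx)
  simp_rw [h]
  rw [volume_setOf_enorm_le hR, ← ENNReal.rpow_natCast, ← ENNReal.rpow_mul,
    show α⁻¹ * ((2 : ℕ) : ℝ) = 2 / α by push_cast; ring,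
    ENNReal.div_rpow_of_nonneg _ _ (by positivity), ENNReal.rpow_neg, div_eq_mul_inv]

theorem expMeasure_one_setOf_ofReal_le (t : ℝ≥0∞) :
    expMeasure 1 {x | ENNReal.ofReal x ≤ t} = 1 - expNeg t := by
  have : IsProbabilityMeasure (expMeasure 1) := isProbabilityMeasure_expMeasure one_pos
  rw [← expMeasure_one_setOf_lt_ofReal, ← prob_compl_eq_one_sub
    (measurableSet_lt measurable_const ENNReal.measurable_ofReal)]
  congr 1
  ext x
  simp

theorem expMeasure_one_ae_pos : ∀ᵐ x ∂(expMeasure 1), 0 < x := by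
  have : IsProbabilityMeasure (expMeasure 1) := isProbabilityMeasure_expMeasure one_pos
  have h := expMeasure_one_setOf_lt_ofReal 0
  simp only [ENNReal.ofReal_pos, expNeg_zero] at h
  exact (prob_compl_eq_zero_iff measurableSet_Ioi).2 h

/-- The factor by which an interferer at `v` reduces the coverage probability under Rayleigh
fading. -/
noncomputable def fadingFactor (α : ℝ) (s : ℝ≥0∞) (v : Plane) : ℝ≥0∞ := (1 + s * ‖v‖ₑ ^ (-α))⁻¹

theorem fadingFactor_le_one (α : ℝ) (s : ℝ≥0∞) (v : Plane) : fadingFactor α s v ≤ 1 :=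
  ENNReal.inv_le_one.2 le_self_add

theorem continuous_fadingFactor (α : ℝ) {s : ℝ≥0∞} (hs : s ≠ ∞) :
    Continuous (fadingFactor α s) := by
  refine continuous_inv.comp (continuous_const.add ((ENNReal.continuous_const_mul hs).comp ?_))
  exact ENNReal.continuous_rpow_const.comp continuous_enorm

theorem measurable_fadingFactor {S : Type*} [MeasurableSpace S] (α : ℝ) {f : S → ℝ≥0∞}
    {g : S → Plane} (hf : Measurable f) (hg : Measurable g) :
    Measurable fun x => fadingFactor α (f x) (g x) :=
  (measurable_const.add (hf.mul (hg.enorm.pow_const _))).inv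

theorem fadingFactor_ne_zero {α : ℝ} {s : ℝ≥0∞} (hs : s ≠ ∞) {v : Plane} (hv : v ≠ 0) :
    fadingFactor α s v ≠ 0 := by
  have h : ‖v‖ₑ ^ (-α) ≠ ∞ := by
    have h0 : ‖v‖ₑ ≠ 0 := by simpa using hv
    simp [ENNReal.rpow_eq_top_iff, h0]
  exact ENNReal.inv_ne_zero.2 (ENNReal.add_ne_top.2 ⟨ENNReal.one_ne_top, ENNReal.mul_ne_top hs h⟩)

/-- The integrand is the probability that `x ≤ s ‖v‖ ^ (-α) g` for independent exponential `g` and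
`x`. By Tonelli the area of the disc of such `v`, `π (s g / x) ^ (2/α)`, is averaged instead, and
the moments of `g` and `1/x` are the two Gamma values. -/
theorem lintegral_one_sub_fadingFactor {α : ℝ} (hα : 2 < α) {s : ℝ≥0∞} (hs : s ≠ 0)
    (hs' : s ≠ ∞) :
    ∫⁻ v, (1 - fadingFactor α s v) =
      s ^ (2 / α) * ENNReal.ofReal
        (Real.pi * Real.Gamma (1 + 2 / α) * Real.Gamma (1 - 2 / α)) := by
  have hE : IsProbabilityMeasure (expMeasure 1) := isProbabilityMeasure_expMeasure one_pos
  have hα0 : 0 < α := by linarith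
  have h2α : 2 / α < 1 := (div_lt_one hα0).2 hα
  have h2α0 : 0 < 2 / α := by positivity
  let A : Set ((Plane × ℝ) × ℝ) :=
    {p | ENNReal.ofReal p.2 ≤ s * ‖p.1.1‖ₑ ^ (-α) * ENNReal.ofReal p.1.2}
  have hA : MeasurableSet A := by
    refine measurableSet_le (ENNReal.measurable_ofReal.comp measurable_snd) ?_
    exact (((measurable_fst.comp measurable_fst).enorm.pow_const _).const_mul s).mul
      (ENNReal.measurable_ofReal.comp (measurable_snd.comp measurable_fst))
  have hAm : Measurable (A.indicator (1 : (Plane × ℝ) × ℝ → ℝ≥0∞)) := measurable_one.indicator hA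
  have h1 : ∀ v : Plane, 1 - fadingFactor α s v =
      ∫⁻ g, ∫⁻ x, A.indicator 1 ((v, g), x) ∂(expMeasure 1) ∂(expMeasure 1) := by
    intro v
    rw [fadingFactor, ← lintegral_expNeg_expMeasure_one, ← lintegral_one_sub_of_le_one
      (measurable_expNeg_mul_ofReal _) fun x => expNeg_le_one _]
    refine lintegral_congr fun g => ?_
    rw [← expMeasure_one_setOf_ofReal_le, ← lintegral_indicator_one
      (measurableSet_le ENNReal.measurable_ofReal measurable_const)]
    rfl
  have h2 : ∀ g x : ℝ, 0 < g → 0 < x → ∫⁻ v : Plane, A.indicator 1 ((v, g), x) =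
      (s ^ (2 / α) * ENNReal.ofReal Real.pi * ENNReal.ofReal g ^ (2 / α)) *
        ENNReal.ofReal x ^ (-(2 / α)) := by
    intro g x hg hx
    have hset : ∀ v : Plane, A.indicator (1 : (Plane × ℝ) × ℝ → ℝ≥0∞) ((v, g), x) =
        {v : Plane | ENNReal.ofReal x ≤ s * ENNReal.ofReal g * ‖v‖ₑ ^ (-α)}.indicator 1 v := by
      intro v
      rw [Set.indicator_apply, Set.indicator_apply]
      simp only [A, Set.mem_ofPred_eq, mul_right_comm s, Pi.one_apply]
    rw [lintegral_congr hset, lintegral_indicator_one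
      (measurableSet_le measurable_const ((measurable_enorm.pow_const _).const_mul _)),
      volume_setOf_le_mul_enorm_rpow hα0 (by simpa using hx) ENNReal.ofReal_ne_top
      (mul_ne_zero hs (by simpa using hg)) (ENNReal.mul_ne_top hs' ENNReal.ofReal_ne_top),
      ENNReal.mul_rpow_of_nonneg _ _ h2α0.le]
    ring
  have hsw : ∫⁻ v, (1 - fadingFactor α s v) =
      ∫⁻ g, ∫⁻ x, (∫⁻ v : Plane, A.indicator 1 ((v, g), x)) ∂(expMeasure 1) ∂(expMeasure 1) := by
    rw [lintegral_congr h1, lintegral_lintegral_swap]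
    · refine lintegral_congr fun g => lintegral_lintegral_swap ?_
      exact (hAm.comp ((measurable_fst.prodMk measurable_const).prodMk
        measurable_snd)).aemeasurable
    · exact hAm.lintegral_prod_right'.aemeasurable
  rw [hsw]
  have h3 : ∀ᵐ g ∂(expMeasure 1), ∫⁻ x, (∫⁻ v : Plane, A.indicator 1 ((v, g), x)) ∂(expMeasure 1) =
      (s ^ (2 / α) * ENNReal.ofReal Real.pi * ENNReal.ofReal (Real.Gamma (1 - 2 / α))) *
        ENNReal.ofReal g ^ (2 / α) := by
    filter_upwards [expMeasure_one_ae_pos] with g hg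
    rw [lintegral_congr_ae (expMeasure_one_ae_pos.mono fun x hx => h2 g x hg hx),
      lintegral_const_mul _ (ENNReal.measurable_ofReal.pow_const _),
      lintegral_rpow_expMeasure_one (by linarith), ← sub_eq_add_neg]
    ring
  rw [lintegral_congr_ae h3, lintegral_const_mul _ (ENNReal.measurable_ofReal.pow_const _),
    lintegral_rpow_expMeasure_one (by linarith), ENNReal.ofReal_mul (by positivity),
    ENNReal.ofReal_mul (by positivity)]
  ring

/-! ### Averaging over the displacement of an interferer -/

section MeanFactor

variable (ν : Measure Plane)

/-- The mean of `fadingFactor` over the displacement of the interferer from a center at `v`. -/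
noncomputable def meanFadingFactor (α : ℝ) (s : ℝ≥0∞) (v : Plane) : ℝ≥0∞ :=
  ∫⁻ y, fadingFactor α s (v + y) ∂ν

theorem measurable_meanFadingFactor [SFinite ν] {S : Type*} [MeasurableSpace S] (α : ℝ)
    {f : S → ℝ≥0∞} {g : S → Plane} (hf : Measurable f) (hg : Measurable g) :
    Measurable fun x => meanFadingFactor ν α (f x) (g x) := by
  have h : Measurable fun p : S × Plane => fadingFactor α (f p.1) (g p.1 + p.2) :=
    measurable_fadingFactor α (hf.comp measurable_fst) ((hg.comp measurable_fst).add measurable_snd)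
  exact h.lintegral_prod_right'

variable [IsProbabilityMeasure ν]

theorem meanFadingFactor_le_one (α : ℝ) (s : ℝ≥0∞) (v : Plane) : meanFadingFactor ν α s v ≤ 1 :=
  (lintegral_mono fun _ => fadingFactor_le_one _ _ _).trans (by simp)

/-- The factor can vanish only when the interferer sits exactly at the receiver, a null event. This
supplies the finiteness of `negLog` that `mecke` demands. -/
theorem meanFadingFactor_ne_zero [NullSingletonClass ν] {α : ℝ} {s : ℝ≥0∞} (hs : s ≠ ∞) (v : Plane) :
    meanFadingFactor ν α s v ≠ 0 := by
  have hm : Measurable fun y => fadingFactor α s (v + y) :=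
    (continuous_fadingFactor α hs).measurable.comp (measurable_const_add v)
  rw [meanFadingFactor, Ne, lintegral_eq_zero_iff hm]
  intro h
  have hf : ∀ᵐ _ ∂ν, False := by
    filter_upwards [h, ν.ae_ne (-v)] with y hy hy'
    exact fadingFactor_ne_zero hs (fun h0 => hy' (eq_neg_of_add_eq_zero_right h0)) hy
  simp at hf
  exact IsProbabilityMeasure.ne_zero ν hf

theorem continuous_meanFadingFactor (α : ℝ) {s : ℝ≥0∞} (hs : s ≠ ∞) :
    Continuous (meanFadingFactor ν α s) := by
  refine continuous_iff_continuousAt.2 fun v => ?_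
  refine tendsto_lintegral_filter_of_dominated_convergence (fun _ => 1)
    (Eventually.of_forall fun v => (continuous_fadingFactor α hs).measurable.comp
      (measurable_const_add v))
    (Eventually.of_forall fun v => Eventually.of_forall fun y => fadingFactor_le_one _ _ _)
    (by simp) (Eventually.of_forall fun y => ?_)
  exact ((continuous_fadingFactor α hs).comp (continuous_add_const y)).continuousAt

/-- After Tonelli, each displacement merely translates the integrand over the plane, so the law `ν`
has no effect. -/
theorem lintegral_one_sub_meanFadingFactor (α : ℝ) {s : ℝ≥0∞} (hs : s ≠ ∞) :
    ∫⁻ v, (1 - meanFadingFactor ν α s v) = ∫⁻ v, (1 - fadingFactor α s v) := by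
  have hm := (continuous_fadingFactor α hs).measurable
  have h1 : ∀ v, 1 - meanFadingFactor ν α s v = ∫⁻ y, (1 - fadingFactor α s (v + y)) ∂ν :=
    fun v => (lintegral_one_sub_of_le_one (hm.comp (measurable_const_add v))
      fun y => fadingFactor_le_one _ _ _).symm
  rw [lintegral_congr h1, lintegral_lintegral_swap]
  · rw [lintegral_congr fun y => lintegral_add_right_eq_self
      (fun v => 1 - fadingFactor α s v) y]
    simp
  · exact (measurable_const.sub (hm.comp (measurable_fst.add measurable_snd))).aemeasurable

end MeanFactor

/-! ### Gaussian integrals -/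

theorem lintegral_exp_neg_mul_sq_norm {b : ℝ} (hb : 0 < b) :
    ∫⁻ v : Plane, ENNReal.ofReal (Real.exp (-b * ‖v‖ ^ 2)) = ENNReal.ofReal (Real.pi / b) := by
  have h := GaussianFourier.integral_rexp_neg_mul_sq_norm (V := Plane) hb
  rw [finrank_euclideanSpace_fin, show (((2 : ℕ) : ℝ) / 2) = 1 by norm_num, Real.rpow_one] at h
  have hint : Integrable fun v : Plane => Real.exp (-b * ‖v‖ ^ 2) := by
    by_contra hn
    rw [integral_undef hn] at h
    exact (div_pos Real.pi_pos hb).ne h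
  rw [← h, ofReal_integral_eq_lintegral_ofReal hint
    (Eventually.of_forall fun v => (Real.exp_pos _).le)]

/-- Completing the square: the Gaussian is recentered at `w / (2b)`. -/
theorem lintegral_exp_neg_mul_sq_norm_add_inner {b : ℝ} (hb : 0 < b) (w : Plane) :
    ∫⁻ v : Plane, ENNReal.ofReal (Real.exp (-b * ‖v‖ ^ 2 + inner ℝ w v)) =
      ENNReal.ofReal (Real.pi / b * Real.exp (‖w‖ ^ 2 / (4 * b))) := by
  have h : ∀ v : Plane, ENNReal.ofReal (Real.exp (-b * ‖v‖ ^ 2 + inner ℝ w v)) =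
      ENNReal.ofReal (Real.exp (-b * ‖v - (1 / (2 * b)) • w‖ ^ 2)) *
        ENNReal.ofReal (Real.exp (‖w‖ ^ 2 / (4 * b))) := by
    intro v
    rw [← ENNReal.ofReal_mul (Real.exp_pos _).le, ← Real.exp_add, norm_sub_sq_real,
      inner_smul_right, norm_smul, mul_pow, Real.norm_eq_abs, sq_abs, real_inner_comm]
    congr 2
    field_simp
    ring
  rw [lintegral_congr h, lintegral_mul_const' _ _ ENNReal.ofReal_ne_top,
    lintegral_sub_right_eq_self (fun v : Plane => ENNReal.ofReal (Real.exp (-b * ‖v‖ ^ 2))),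
    lintegral_exp_neg_mul_sq_norm hb, ← ENNReal.ofReal_mul (by positivity)]

theorem measurable_displacementDensity (σ : ℝ) : Measurable fun y : Plane =>
    ENNReal.ofReal (1 / (2 * Real.pi * σ ^ 2) * Real.exp (-‖y‖ ^ 2 / (2 * σ ^ 2))) := by
  fun_prop

theorem lintegral_displacementLaw (σ : ℝ) {f : Plane → ℝ≥0∞} (hf : Measurable f) :
    ∫⁻ y, f y ∂(displacementLaw σ) = ∫⁻ y, ENNReal.ofReal
      (1 / (2 * Real.pi * σ ^ 2) * Real.exp (-‖y‖ ^ 2 / (2 * σ ^ 2))) * f y :=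
  lintegral_withDensity_eq_lintegral_mul _ (measurable_displacementDensity σ) hf

instance nullSingletonClass_displacementLaw (σ : ℝ) :
    NullSingletonClass (displacementLaw σ) :=
  ⟨fun x => withDensity_absolutelyContinuous _ _ (measure_singleton x)⟩

/-- The mean of a Gaussian function of the distance between two cluster members. -/
theorem lintegral_lintegral_exp_neg_mul_sq_dist {σ : ℝ} (hσ : 0 < σ) {c : ℝ} (hc : 0 ≤ c) :
    ∫⁻ z, ∫⁻ y, ENNReal.ofReal (Real.exp (-(c * ‖y - z‖ ^ 2))) ∂(displacementLaw σ)
      ∂(displacementLaw σ) = ENNReal.ofReal (1 / (1 + 4 * σ ^ 2 * c)) := by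
  set a : ℝ := 1 / (2 * σ ^ 2) with ha
  have ha0 : 0 < a := by positivity
  have hac : 0 < a + c := by linarith
  have hdens : ∀ y : Plane, 1 / (2 * Real.pi * σ ^ 2) * Real.exp (-‖y‖ ^ 2 / (2 * σ ^ 2)) =
      a / Real.pi * Real.exp (-a * ‖y‖ ^ 2) := by
    intro y
    rw [ha]
    congr 1
    · field_simp
    · congr 1
      field_simp
  -- Integrating out `y` leaves a Gaussian in `z` with rate `a c / (a + c)`; the outer integral then
  -- equals `a / (a + 2c)`.
  have hinner : ∀ z : Plane,
      ∫⁻ y, ENNReal.ofReal (Real.exp (-(c * ‖y - z‖ ^ 2))) ∂(displacementLaw σ) =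
        ENNReal.ofReal (a / (a + c) * Real.exp (-(a * c / (a + c)) * ‖z‖ ^ 2)) := by
    intro z
    rw [lintegral_displacementLaw σ (by fun_prop)]
    have h : ∀ y : Plane, ENNReal.ofReal
        (1 / (2 * Real.pi * σ ^ 2) * Real.exp (-‖y‖ ^ 2 / (2 * σ ^ 2))) *
        ENNReal.ofReal (Real.exp (-(c * ‖y - z‖ ^ 2))) =
        ENNReal.ofReal (a / Real.pi * Real.exp (-c * ‖z‖ ^ 2)) *
        ENNReal.ofReal (Real.exp (-(a + c) * ‖y‖ ^ 2 + inner ℝ ((2 * c) • z) y)) := by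
      intro y
      rw [hdens, ← ENNReal.ofReal_mul (by positivity), ← ENNReal.ofReal_mul (by positivity),
        mul_assoc, mul_assoc, ← Real.exp_add, ← Real.exp_add, norm_sub_sq_real, inner_smul_left,
        real_inner_comm]
      congr 3
      simp only [conj_trivial]
      ring
    rw [lintegral_congr h, lintegral_const_mul' _ _ ENNReal.ofReal_ne_top,
      lintegral_exp_neg_mul_sq_norm_add_inner hac, ← ENNReal.ofReal_mul (by positivity)]
    congr 1
    have e : a / Real.pi * Real.exp (-c * ‖z‖ ^ 2) *
        (Real.pi / (a + c) * Real.exp (‖(2 * c) • z‖ ^ 2 / (4 * (a + c)))) =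
        a / (a + c) * (Real.exp (-c * ‖z‖ ^ 2) *
          Real.exp (‖(2 * c) • z‖ ^ 2 / (4 * (a + c)))) := by
      field_simp
    rw [e, ← Real.exp_add, norm_smul, mul_pow, Real.norm_eq_abs, sq_abs]
    congr 2
    field_simp
    ring
  rw [lintegral_congr hinner, lintegral_displacementLaw σ (by fun_prop)]
  have h : ∀ z : Plane, ENNReal.ofReal
      (1 / (2 * Real.pi * σ ^ 2) * Real.exp (-‖z‖ ^ 2 / (2 * σ ^ 2))) *
      ENNReal.ofReal (a / (a + c) * Real.exp (-(a * c / (a + c)) * ‖z‖ ^ 2)) =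
      ENNReal.ofReal (a / Real.pi * (a / (a + c))) *
      ENNReal.ofReal (Real.exp (-(a + a * c / (a + c)) * ‖z‖ ^ 2)) := by
    intro z
    rw [hdens, ← ENNReal.ofReal_mul (by positivity), ← ENNReal.ofReal_mul (by positivity),
      mul_mul_mul_comm, ← Real.exp_add]
    congr 3
    ring
  rw [lintegral_congr h, lintegral_const_mul' _ _ ENNReal.ofReal_ne_top,
    lintegral_exp_neg_mul_sq_norm (by positivity), ← ENNReal.ofReal_mul (by positivity)]
  congr 1
  have e : 1 + 4 * σ ^ 2 * c = (a + 2 * c) / a := by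
    rw [ha]
    field_simp
    ring
  have h2 : 0 < a + 2 * c := by linarith
  have h3 : a + a * c / (a + c) = a * (a + 2 * c) / (a + c) := by
    field_simp
    ring
  rw [e, h3]
  field_simp

/-! ### The coverage event on the canonical space -/

namespace D2DNetwork

variable {Ω : Type*} {n : ℕ}

/-- The displacement of the transmitter of cluster `i` from the cluster center. -/
def txDisplacement (N : D2DNetwork Ω n) (i : ℕ) (ω : Ω) : Plane :=
  N.displacement i (N.tx i ω) ω

/-- The displacement of the receiver of cluster `i` from the cluster center. -/
def rxDisplacement (N : D2DNetwork Ω n) (i : ℕ) (ω : Ω) : Plane :=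
  N.displacement i (N.rx i ω) ω

/-- The normalized threshold `θ ‖y - z‖ ^ α` of a link from `y` to `z`. -/
noncomputable def _root_.linkThreshold (θ α : ℝ) (p : Plane × Plane) : ℝ≥0∞ :=
  ENNReal.ofReal θ * ‖p.1 - p.2‖ₑ ^ α

/-- In the direct link the common center cancels. The transmit power and the path loss of that link
are positive and finite, so they can be divided out. -/
theorem lt_sir_iff (N : D2DNetwork Ω n) {Pd α θ : ℝ} (hPd : 0 < Pd) (hθ : 0 < θ)
    {i : ℕ} {ω : Ω} (h : N.txDisplacement i ω ≠ N.rxDisplacement i ω) :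
    ENNReal.ofReal θ < N.sir Pd α i ω ↔
      ∑' j : {j // j ≠ i}, linkThreshold θ α (N.txDisplacement i ω, N.rxDisplacement i ω) *
        ‖N.center j ω + N.txDisplacement j ω - N.receiver i ω‖ₑ ^ (-α) *
          ENNReal.ofReal (N.fading i j ω) < ENNReal.ofReal (N.fading i i ω) := by
  have hp0 : ENNReal.ofReal Pd ≠ 0 := by simpa using hPd
  have hv : ‖N.txDisplacement i ω - N.rxDisplacement i ω‖ₑ ≠ 0 := by simpa [sub_eq_zero] using h
  set L := ‖N.txDisplacement i ω - N.rxDisplacement i ω‖ₑ ^ (-α) with hL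
  have hL0 : L ≠ 0 := by simp [hL, ENNReal.rpow_eq_zero_iff, hv]
  have hLt : L ≠ ∞ := by simp [hL, ENNReal.rpow_eq_top_iff, hv]
  have hLi : linkThreshold θ α (N.txDisplacement i ω, N.rxDisplacement i ω) =
      ENNReal.ofReal θ * L⁻¹ := by
    rw [linkThreshold, hL, ENNReal.rpow_neg, inv_inv]
  have hpow : N.power Pd α i i ω = ENNReal.ofReal Pd * L * ENNReal.ofReal (N.fading i i ω) := by
    have e : N.relCenter i i ω + N.displacement i (N.tx i ω) ω =
        N.txDisplacement i ω - N.rxDisplacement i ω := by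
      simp only [relCenter, receiver, txDisplacement, rxDisplacement]
      abel
    rw [power, e, ← hL]
    ring
  have hint : N.interference Pd α i ω = ENNReal.ofReal Pd * ∑' j : {j // j ≠ i},
      ‖N.center j ω + N.txDisplacement j ω - N.receiver i ω‖ₑ ^ (-α) *
        ENNReal.ofReal (N.fading i j ω) := by
    rw [interference, ← ENNReal.tsum_mul_left]
    refine tsum_congr fun j => ?_
    rw [power, mul_assoc, mul_comm (ENNReal.ofReal (N.fading i j ω)), relCenter, txDisplacement,
      sub_add_eq_add_sub]
  -- The interference may be `0` or `∞`; clearing the denominator is still valid since the threshold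
  -- is neither.
  rw [sir, ENNReal.lt_div_iff_mul_lt (Or.inr ENNReal.ofReal_ne_top)
    (Or.inr (by simpa using hθ)), hpow, hint, hLi]
  simp_rw [mul_assoc (ENNReal.ofReal θ * L⁻¹)]
  rw [ENNReal.tsum_mul_left]
  set T := ∑' j : {j // j ≠ i}, ‖N.center j ω + N.txDisplacement j ω - N.receiver i ω‖ₑ ^ (-α) *
        ENNReal.ofReal (N.fading i j ω)
  have e : ENNReal.ofReal θ * (ENNReal.ofReal Pd * T) =
      ENNReal.ofReal Pd * L * (ENNReal.ofReal θ * L⁻¹ * T) := by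
    calc _ = ENNReal.ofReal Pd * (L * L⁻¹) * (ENNReal.ofReal θ * T) := by
          rw [ENNReal.mul_inv_cancel hL0 hLt]; ring
      _ = _ := by ring
  rw [e]
  exact ENNReal.mul_lt_mul_iff_right (mul_ne_zero hp0 hL0)
    (ENNReal.mul_ne_top ENNReal.ofReal_ne_top hLt)

/-- The network on the space of all values of the random ingredients. -/
def canonical (n : ℕ) : D2DNetwork
    ((ℕ → Plane) × (ℕ → Fin n → Plane) × (ℕ → ℕ → ℝ) × (ℕ → Fin n × Fin n)) n where
  center i p := p.1 i
  displacement i k p := p.2.1 i k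
  fading i j p := p.2.2.1 i j
  tx i p := (p.2.2.2 i).1
  rx i p := (p.2.2.2 i).2

section Measurability

theorem measurable_canonical_center (i : ℕ) : Measurable ((canonical n).center i) :=
  (measurable_pi_apply i).comp measurable_fst

theorem measurable_canonical_fading (i j : ℕ) : Measurable ((canonical n).fading i j) :=
  (measurable_pi_apply j).comp ((measurable_pi_apply i).comp
    (measurable_fst.comp (measurable_snd.comp measurable_snd)))

theorem measurable_canonical_schedule (i : ℕ) : Measurable fun p :
    (ℕ → Plane) × (ℕ → Fin n → Plane) × (ℕ → ℕ → ℝ) × (ℕ → Fin n × Fin n) => p.2.2.2 i :=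
  (measurable_pi_apply i).comp (measurable_snd.comp (measurable_snd.comp measurable_snd))

/-- Evaluation at a random member is measurable because there are finitely many members. -/
theorem measurable_apply_fin : Measurable fun p : (Fin n → Plane) × Fin n => p.1 p.2 :=
  measurable_from_prod_countable_left fun k => measurable_pi_apply k

theorem measurable_canonical_displacement (i : ℕ) : Measurable fun p :
    (ℕ → Plane) × (ℕ → Fin n → Plane) × (ℕ → ℕ → ℝ) × (ℕ → Fin n × Fin n) => p.2.1 i :=
  (measurable_pi_apply i).comp (measurable_fst.comp measurable_snd)

theorem measurable_canonical_txDisplacement (i : ℕ) :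
    Measurable ((canonical n).txDisplacement i) :=
  measurable_apply_fin.comp ((measurable_canonical_displacement i).prodMk
    (measurable_fst.comp (measurable_canonical_schedule i)))

theorem measurable_canonical_rxDisplacement (i : ℕ) :
    Measurable ((canonical n).rxDisplacement i) :=
  measurable_apply_fin.comp ((measurable_canonical_displacement i).prodMk
    (measurable_snd.comp (measurable_canonical_schedule i)))

theorem measurable_canonical_receiver (i : ℕ) : Measurable ((canonical n).receiver i) :=
  (measurable_canonical_center i).add (measurable_canonical_rxDisplacement i)

theorem measurable_canonical_power (Pd α : ℝ) (i j : ℕ) :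
    Measurable ((canonical n).power Pd α i j) :=
  ((ENNReal.measurable_ofReal.comp (measurable_canonical_fading i j)).const_mul _).mul
    ((((measurable_canonical_center j).sub (measurable_canonical_receiver i)).add
      (measurable_canonical_txDisplacement j)).enorm.pow_const _)

theorem measurable_canonical_sir (Pd α : ℝ) (i : ℕ) :
    Measurable ((canonical n).sir Pd α i) :=
  (measurable_canonical_power Pd α i i).div
    (Measurable.tsum fun j => measurable_canonical_power Pd α i j)

theorem measurableSet_canonical_covered {B : Set Plane} (hB : MeasurableSet B)
    (Pd α θ : ℝ) (i : ℕ) : MeasurableSet {p | (canonical n).receiver i p ∈ B ∧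
      ENNReal.ofReal θ < (canonical n).sir Pd α i p} :=
  ((measurable_canonical_receiver i) hB).inter
    (measurableSet_lt measurable_const (measurable_canonical_sir Pd α i))

end Measurability

/-- The values of the random ingredients. -/
def ingredients (N : D2DNetwork Ω n) (ω₁ ω₂ ω₃ ω₄ : Ω) :
    (ℕ → Plane) × (ℕ → Fin n → Plane) × (ℕ → ℕ → ℝ) × (ℕ → Fin n × Fin n) :=
  (fun i => N.center i ω₁, fun i k => N.displacement i k ω₂, fun i j => N.fading i j ω₃,
    fun i => (N.tx i ω₄, N.rx i ω₄))

namespace IsGaussianRayleigh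

variable [MeasurableSpace Ω] {N : D2DNetwork Ω n} {μ : Measure Ω} {lam σ : ℝ}

theorem measurable_centers (hN : N.IsGaussianRayleigh μ lam σ) :
    Measurable fun ω i => N.center i ω :=
  measurable_pi_lambda _ fun i => hN.poisson.measurable i

theorem measurable_displacements (hN : N.IsGaussianRayleigh μ lam σ) :
    Measurable fun ω i k => N.displacement i k ω :=
  measurable_pi_lambda _ fun i => measurable_pi_lambda _ fun k => hN.measurable_displacement i k

theorem measurable_fadings (hN : N.IsGaussianRayleigh μ lam σ) :
    Measurable fun ω i j => N.fading i j ω :=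
  measurable_pi_lambda _ fun i => measurable_pi_lambda _ fun j => hN.measurable_fading i j

theorem measurable_schedule (hN : N.IsGaussianRayleigh μ lam σ) :
    Measurable fun ω i => (N.tx i ω, N.rx i ω) :=
  measurable_pi_lambda _ fun i => (hN.measurable_tx i).prodMk (hN.measurable_rx i)

/-- Independence of the four families of random ingredients. -/
theorem lintegral_ingredients [IsProbabilityMeasure μ] (hN : N.IsGaussianRayleigh μ lam σ)
    {Φ : (ℕ → Plane) × (ℕ → Fin n → Plane) × (ℕ → ℕ → ℝ) × (ℕ → Fin n × Fin n) → ℝ≥0∞}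
    (hΦ : Measurable Φ) :
    ∫⁻ ω, Φ (N.ingredients ω ω ω ω) ∂μ =
      ∫⁻ ω₁, ∫⁻ ω₄, ∫⁻ ω₂, ∫⁻ ω₃, Φ (N.ingredients ω₁ ω₂ ω₃ ω₄) ∂μ ∂μ ∂μ ∂μ := by
  have hX := hN.measurable_centers
  have hD := hN.measurable_displacements
  have hG := hN.measurable_fadings
  have hS := hN.measurable_schedule
  refine (hN.indep_center.lintegral_eq_lintegral_lintegral (Φ := fun x r => Φ (x, r)) hX
    (hD.prodMk (hG.prodMk hS)) hΦ).trans (lintegral_congr fun ω₁ => ?_)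
  have h1 : Measurable fun r : (ℕ → Fin n → Plane) × (ℕ → ℕ → ℝ) × (ℕ → Fin n × Fin n) =>
      Φ (fun i => N.center i ω₁, r) := hΦ.comp measurable_prodMk_left
  refine (hN.indep_displacement.lintegral_eq_lintegral_lintegral
    (Φ := fun d r => Φ (fun i => N.center i ω₁, d, r)) hD (hG.prodMk hS) h1).trans ?_
  have h2 : ∀ ω₂, ∫⁻ ω, Φ (fun i => N.center i ω₁, fun i k => N.displacement i k ω₂,
      fun i j => N.fading i j ω, fun i => (N.tx i ω, N.rx i ω)) ∂μ =
      ∫⁻ ω₄, ∫⁻ ω₃, Φ (N.ingredients ω₁ ω₂ ω₃ ω₄) ∂μ ∂μ := by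
    intro ω₂
    have h3 : Measurable fun r : (ℕ → ℕ → ℝ) × (ℕ → Fin n × Fin n) =>
        Φ (fun i => N.center i ω₁, fun i k => N.displacement i k ω₂, r) :=
      h1.comp measurable_prodMk_left
    refine (hN.indep_fading.lintegral_eq_lintegral_lintegral
      (Φ := fun g s => Φ (fun i => N.center i ω₁, fun i k => N.displacement i k ω₂, g, s))
      hG hS h3).trans ?_
    exact lintegral_lintegral_swap (h3.comp ((hG.comp measurable_fst).prodMk
      (hS.comp measurable_snd))).aemeasurable
  -- Two Tonelli exchanges, here and in `h2`, move the schedule outside the displacements and the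
  -- fading: with the active members fixed, the displacements that matter are a fixed subfamily.
  rw [lintegral_congr h2]
  refine lintegral_lintegral_swap ?_
  have h4 : Measurable fun q : (Ω × Ω) × Ω => Φ (N.ingredients ω₁ q.1.1 q.2 q.1.2) :=
    h1.comp ((hD.comp (measurable_fst.comp measurable_fst)).prodMk
      ((hG.comp measurable_snd).prodMk (hS.comp (measurable_snd.comp measurable_fst))))
  exact h4.lintegral_prod_right'.aemeasurable

end IsGaussianRayleigh

end D2DNetwork

/-! ### Conditional coverage -/

theorem measurable_linkThreshold (θ α : ℝ) : Measurable (linkThreshold θ α) :=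
  ((measurable_fst.sub measurable_snd).enorm.pow_const _).const_mul _

/-- The probability that the receiver of cluster `i` is in `B` and covered, given the cluster
centers `x` and the displacements `p` of the transmitter and the receiver of cluster `i`. -/
noncomputable def conditionalCoverage (ν : Measure Plane) (α θ : ℝ) (B : Set Plane) (i : ℕ)
    (x : ℕ → Plane) (p : Plane × Plane) : ℝ≥0∞ :=
  B.indicator 1 (x i + p.2) * expNeg (∑' j : {j // j ≠ i},
    negLog (meanFadingFactor ν α (linkThreshold θ α p) (x j - (x i + p.2))))

theorem measurable_conditionalCoverage (ν : Measure Plane) [SFinite ν] (α θ : ℝ) {B : Set Plane}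
    (hB : MeasurableSet B) (i : ℕ) : Measurable fun q : (ℕ → Plane) × Plane × Plane =>
      conditionalCoverage ν α θ B i q.1 q.2 := by
  have hw : Measurable fun q : (ℕ → Plane) × Plane × Plane => q.1 i + q.2.2 := by fun_prop
  have hind : Measurable fun q : (ℕ → Plane) × Plane × Plane =>
      B.indicator (1 : Plane → ℝ≥0∞) (q.1 i + q.2.2) := (measurable_one.indicator hB).comp hw
  have hsum : Measurable fun q : (ℕ → Plane) × Plane × Plane => ∑' j : {j // j ≠ i},
      negLog (meanFadingFactor ν α (linkThreshold θ α q.2) (q.1 j - (q.1 i + q.2.2))) := by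
    refine Measurable.tsum fun j => measurable_negLog.comp ?_
    have hT : Measurable fun q : (ℕ → Plane) × Plane × Plane => linkThreshold θ α q.2 :=
      (measurable_linkThreshold θ α).comp measurable_snd
    have hv : Measurable fun q : (ℕ → Plane) × Plane × Plane => q.1 j - (q.1 i + q.2.2) := by
      fun_prop
    exact measurable_meanFadingFactor ν α hT hv
  exact hind.mul (measurable_expNeg.comp hsum)

theorem indicator_one_ne_top {S : Type*} (A : Set S) (x : S) :
    A.indicator (1 : S → ℝ≥0∞) x ≠ ∞ := by
  by_cases h : x ∈ A <;> simp [h]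

/-- Sections of the diagonal are singletons. This rules out a link of length zero almost surely. -/
theorem ae_prod_fst_ne_snd (ν : Measure Plane) [SFinite ν] [NullSingletonClass ν] :
    ∀ᵐ p ∂(ν.prod ν), p.1 ≠ p.2 := by
  have h : MeasurableSet {p : Plane × Plane | p.1 = p.2} := measurableSet_diagonal
  refine ae_iff.2 ?_
  simp only [not_not]
  refine (Measure.measure_prod_null h).2 (Eventually.of_forall fun x => ?_)
  have : Prod.mk x ⁻¹' {p : Plane × Plane | p.1 = p.2} = {x} := by
    ext y
    simp [eq_comm]
  simp [this]

namespace D2DNetwork.IsGaussianRayleigh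

variable {Ω : Type*} {n : ℕ} [MeasurableSpace Ω] {N : D2DNetwork Ω n} {μ : Measure Ω}
  [IsProbabilityMeasure μ] {lam σ : ℝ}

/-- The law is that of an actual random variable, so no integral is needed; a sample point serves to
exhibit a member of `Fin n`. -/
theorem isProbabilityMeasure_displacementLaw (hN : N.IsGaussianRayleigh μ lam σ) :
    IsProbabilityMeasure (displacementLaw σ) := by
  obtain ⟨ω⟩ : Nonempty Ω := nonempty_of_isProbabilityMeasure μ
  rw [← hN.displacement_law 0 (N.tx 0 ω)]
  exact Measure.isProbabilityMeasure_map (hN.measurable_displacement _ _).aemeasurable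

theorem map_displacement_prodMk (hN : N.IsGaussianRayleigh μ lam σ) (i : ℕ) {k l : Fin n}
    (hkl : k ≠ l) : μ.map (fun ω => (N.displacement i k ω, N.displacement i l ω)) =
      (displacementLaw σ).prod (displacementLaw σ) := by
  have h := hN.displacement_indep.indepFun (i := (i, k)) (j := (i, l)) (by simpa using hkl)
  rw [(indepFun_iff_map_prod_eq_prod_map_map (hN.measurable_displacement i k).aemeasurable
    (hN.measurable_displacement i l).aemeasurable).1 h, hN.displacement_law, hN.displacement_law]

/-- Coverage given everything but the fading. -/
theorem lintegral_fading_covered (hN : N.IsGaussianRayleigh μ lam σ) {Pd α θ : ℝ} (hPd : 0 < Pd)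
    (hθ : 0 < θ) (B : Set Plane) (i : ℕ) {ω₁ ω₂ ω₄ : Ω}
    (hne : N.displacement i (N.tx i ω₄) ω₂ ≠ N.displacement i (N.rx i ω₄) ω₂) :
    ∫⁻ ω₃, {p | (canonical n).receiver i p ∈ B ∧
      ENNReal.ofReal θ < (canonical n).sir Pd α i p}.indicator (fun _ => 1)
        (N.ingredients ω₁ ω₂ ω₃ ω₄) ∂μ =
      B.indicator 1 (N.center i ω₁ + N.displacement i (N.rx i ω₄) ω₂) *
        expNeg (∑' j : {j // j ≠ i}, negLog (fadingFactor α (linkThreshold θ α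
          (N.displacement i (N.tx i ω₄) ω₂, N.displacement i (N.rx i ω₄) ω₂))
            (N.center j ω₁ + N.displacement j (N.tx j ω₄) ω₂ -
              (N.center i ω₁ + N.displacement i (N.rx i ω₄) ω₂)))) := by
  set T := linkThreshold θ α
    (N.displacement i (N.tx i ω₄) ω₂, N.displacement i (N.rx i ω₄) ω₂) with hT
  set v : ℕ → Plane := fun j => N.center j ω₁ + N.displacement j (N.tx j ω₄) ω₂ -
    (N.center i ω₁ + N.displacement i (N.rx i ω₄) ω₂) with hv
  have hpt : ∀ ω₃, {p | (canonical n).receiver i p ∈ B ∧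
      ENNReal.ofReal θ < (canonical n).sir Pd α i p}.indicator (fun _ => (1 : ℝ≥0∞))
        (N.ingredients ω₁ ω₂ ω₃ ω₄) =
      B.indicator 1 (N.center i ω₁ + N.displacement i (N.rx i ω₄) ω₂) *
        {ω | ∑' j : {j // j ≠ i}, (T * ‖v j‖ₑ ^ (-α)) * ENNReal.ofReal (N.fading i j ω) <
          ENNReal.ofReal (N.fading i i ω)}.indicator 1 ω₃ := by
    intro ω₃
    have h := lt_sir_iff (canonical n) (Pd := Pd) (α := α) hPd hθ (i := i)
      (ω := N.ingredients ω₁ ω₂ ω₃ ω₄) hne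
    have hiff : N.ingredients ω₁ ω₂ ω₃ ω₄ ∈ {p | (canonical n).receiver i p ∈ B ∧
        ENNReal.ofReal θ < (canonical n).sir Pd α i p} ↔
        N.center i ω₁ + N.displacement i (N.rx i ω₄) ω₂ ∈ B ∧
        ω₃ ∈ {ω | ∑' j : {j // j ≠ i}, (T * ‖v j‖ₑ ^ (-α)) * ENNReal.ofReal (N.fading i j ω) <
          ENNReal.ofReal (N.fading i i ω)} := and_congr Iff.rfl h
    by_cases hw : N.center i ω₁ + N.displacement i (N.rx i ω₄) ω₂ ∈ B
    · by_cases hs : ω₃ ∈ {ω | ∑' j : {j // j ≠ i}, (T * ‖v j‖ₑ ^ (-α)) *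
          ENNReal.ofReal (N.fading i j ω) < ENNReal.ofReal (N.fading i i ω)}
      · rw [Set.indicator_of_mem (hiff.2 ⟨hw, hs⟩), Set.indicator_of_mem hw,
          Set.indicator_of_mem hs, Pi.one_apply, Pi.one_apply, one_mul]
      · rw [Set.indicator_of_notMem fun hm => hs (hiff.1 hm).2, Set.indicator_of_notMem hs,
          mul_zero]
    · rw [Set.indicator_of_notMem fun hm => hw (hiff.1 hm).1, Set.indicator_of_notMem hw,
        zero_mul]
  have hind : iIndepFun (fun j => N.fading i j) μ :=
    hN.fading_indep.precomp (g := fun j : ℕ => (i, j)) fun j k h => (Prod.mk.inj h).2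
  rw [lintegral_congr hpt, lintegral_const_mul' _ _ (indicator_one_ne_top _ _),
    measure_setOf_tsum_mul_lt hind (fun j => hN.measurable_fading i j)
      (fun j => hN.fading_law i j) i (fun j => T * ‖v j‖ₑ ^ (-α))]
  rfl

/-- Coverage given the centers and the scheduling. -/
theorem lintegral_displacement_covered (hN : N.IsGaussianRayleigh μ lam σ) {Pd α θ : ℝ}
    (hPd : 0 < Pd) (hθ : 0 < θ) {B : Set Plane} (hB : MeasurableSet B) (i : ℕ) (ω₁ ω₄ : Ω) :
    ∫⁻ ω₂, ∫⁻ ω₃, {p | (canonical n).receiver i p ∈ B ∧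
      ENNReal.ofReal θ < (canonical n).sir Pd α i p}.indicator (fun _ => 1)
        (N.ingredients ω₁ ω₂ ω₃ ω₄) ∂μ ∂μ =
      ∫⁻ p, conditionalCoverage (displacementLaw σ) α θ B i (fun j => N.center j ω₁) p
        ∂((displacementLaw σ).prod (displacementLaw σ)) := by
  have hγ := hN.isProbabilityMeasure_displacementLaw
  set γ := displacementLaw σ with hγdef
  have hmap := hN.map_displacement_prodMk i (hN.tx_ne_rx i ω₄)
  have hpm : Measurable fun ω => (N.displacement i (N.tx i ω₄) ω, N.displacement i (N.rx i ω₄) ω) :=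
    (hN.measurable_displacement _ _).prodMk (hN.measurable_displacement _ _)
  have hcm : Measurable fun p => conditionalCoverage γ α θ B i (fun j => N.center j ω₁) p :=
    (measurable_conditionalCoverage γ α θ hB i).comp
      (measurable_prodMk_left (x := fun j => N.center j ω₁))
  have hne : ∀ᵐ ω₂ ∂μ, N.displacement i (N.tx i ω₄) ω₂ ≠ N.displacement i (N.rx i ω₄) ω₂ := by
    have h := ae_prod_fst_ne_snd γ
    rw [← hmap] at h
    exact ae_of_ae_map hpm.aemeasurable h
  rw [lintegral_congr_ae (hne.mono fun ω₂ h => hN.lintegral_fading_covered hPd hθ B i h), ← hmap,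
    lintegral_map hcm hpm]
  -- The link of cluster `i` (`true` the transmitter, `false` the receiver) and the transmitters of
  -- the other clusters use disjoint indices, so their displacements are independent.
  let a : Bool → ℕ × Fin n := fun b => (i, if b then N.tx i ω₄ else N.rx i ω₄)
  let b : {j // j ≠ i} → ℕ × Fin n := fun j => (j, N.tx j ω₄)
  have hYm : ∀ p : ℕ × Fin n, Measurable (N.displacement p.1 p.2) :=
    fun p => hN.measurable_displacement p.1 p.2
  have hind := hN.displacement_indep.indepFun_restrict hYm (a := a) (b := b)
    fun _ j h => j.2 (Prod.mk.inj h).1.symm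
  let Φ : (Bool → Plane) → ({j // j ≠ i} → Plane) → ℝ≥0∞ := fun u v =>
    B.indicator 1 (N.center i ω₁ + u false) * expNeg (∑' j : {j // j ≠ i},
      negLog (fadingFactor α (linkThreshold θ α (u true, u false))
        (N.center j ω₁ + v j - (N.center i ω₁ + u false))))
  have hΦ : Measurable (Function.uncurry Φ) := by
    have hw : Measurable fun q : (Bool → Plane) × ({j // j ≠ i} → Plane) =>
      N.center i ω₁ + q.1 false := by fun_prop
    have hi : Measurable fun q : (Bool → Plane) × ({j // j ≠ i} → Plane) =>
        B.indicator (1 : Plane → ℝ≥0∞) (N.center i ω₁ + q.1 false) :=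
      (measurable_one.indicator hB).comp hw
    have hs : Measurable fun q : (Bool → Plane) × ({j // j ≠ i} → Plane) => ∑' j : {j // j ≠ i},
        negLog (fadingFactor α (linkThreshold θ α (q.1 true, q.1 false))
          (N.center j ω₁ + q.2 j - (N.center i ω₁ + q.1 false))) := by
      refine Measurable.tsum fun j => measurable_negLog.comp ?_
      have hp : Measurable fun q : (Bool → Plane) × ({j // j ≠ i} → Plane) =>
          (q.1 true, q.1 false) := by fun_prop
      have hT : Measurable fun q : (Bool → Plane) × ({j // j ≠ i} → Plane) =>
          linkThreshold θ α (q.1 true, q.1 false) := (measurable_linkThreshold θ α).comp hp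
      have hv : Measurable fun q : (Bool → Plane) × ({j // j ≠ i} → Plane) =>
          N.center j ω₁ + q.2 j - (N.center i ω₁ + q.1 false) := by fun_prop
      exact measurable_fadingFactor α hT hv
    exact hi.mul (measurable_expNeg.comp hs)
  refine (hind.lintegral_eq_lintegral_lintegral (measurable_pi_lambda _ fun s => hYm _)
    (measurable_pi_lambda _ fun t => hYm _) hΦ).trans (lintegral_congr fun ω => ?_)
  set T := linkThreshold θ α (N.displacement i (N.tx i ω₄) ω, N.displacement i (N.rx i ω₄) ω)
    with hT
  set w := N.center i ω₁ + N.displacement i (N.rx i ω₄) ω with hw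
  have hTm : Measurable (fadingFactor α T) := measurable_fadingFactor α measurable_const measurable_id
  have hfm : ∀ j, Measurable fun y : Plane => fadingFactor α T (N.center j ω₁ + y - w) := fun j =>
    hTm.comp ((measurable_const_add _).sub_const _)
  have hin : ∫⁻ ω', expNeg (∑' j : {j // j ≠ i}, negLog (fadingFactor α T
      (N.center j ω₁ + N.displacement j (N.tx j ω₄) ω' - w))) ∂μ =
      expNeg (∑' j : {j // j ≠ i}, negLog (meanFadingFactor γ α T (N.center j ω₁ - w))) := by
    have hinj : Function.Injective b := fun j k h => Subtype.ext (Prod.mk.inj h).1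
    refine ((hN.displacement_indep.precomp hinj).comp
      (fun j y => negLog (fadingFactor α T (N.center j ω₁ + y - w)))
      fun j => measurable_negLog.comp (hfm j)).lintegral_expNeg_tsum
      (fun j => (measurable_negLog.comp (hfm j)).comp (hYm _)) fun j => ?_
    have hm : Measurable fun y => fadingFactor α T (N.center j ω₁ - w + y) :=
      hTm.comp (measurable_const_add _)
    rw [expNeg_negLog (meanFadingFactor_le_one _ _ _ _), meanFadingFactor, hγdef,
      ← hN.displacement_law j (N.tx j ω₄), lintegral_map hm (hN.measurable_displacement _ _)]
    refine lintegral_congr fun ω' => ?_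
    simp only [Function.comp_apply, b, expNeg_negLog (fadingFactor_le_one _ _ _)]
    rw [sub_add_eq_add_sub]
  have hconst : ∫⁻ ω', Φ (fun s => N.displacement (a s).1 (a s).2 ω)
      (fun t => N.displacement (b t).1 (b t).2 ω') ∂μ = B.indicator 1 w *
      ∫⁻ ω', expNeg (∑' j : {j // j ≠ i}, negLog (fadingFactor α T
        (N.center j ω₁ + N.displacement j (N.tx j ω₄) ω' - w))) ∂μ :=
    lintegral_const_mul' _ _ (indicator_one_ne_top _ _)
  rw [hconst, hin]
  rfl

/-- Coverage given the displacements in the cluster of the typical receiver. -/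
theorem tsum_lintegral_conditionalCoverage (hN : N.IsGaussianRayleigh μ lam σ) {α θ : ℝ}
    (hlam : 0 < lam) (hα : 2 < α) (hθ : 0 < θ) {B : Set Plane} (hB : MeasurableSet B)
    (hB' : volume B ≠ ∞) {p : Plane × Plane} (hp : p.1 ≠ p.2) :
    ∑' i, ∫⁻ ω, conditionalCoverage (displacementLaw σ) α θ B i (fun j => N.center j ω) p ∂μ =
      ENNReal.ofReal lam * volume B * ENNReal.ofReal (Real.exp (-(Real.pi * lam * θ ^ (2 / α) *
        Real.Gamma (1 + 2 / α) * Real.Gamma (1 - 2 / α) * ‖p.1 - p.2‖ ^ 2))) := by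
  have hγ := hN.isProbabilityMeasure_displacementLaw
  set γ := displacementLaw σ with hγdef
  have hα0 : 0 < α := by linarith
  have h2α : 2 / α < 1 := (div_lt_one hα0).2 hα
  have hv : 0 < ‖p.1 - p.2‖ := norm_pos_iff.2 (sub_ne_zero.2 hp)
  have hT : linkThreshold θ α p = ENNReal.ofReal (θ * ‖p.1 - p.2‖ ^ α) := by
    rw [linkThreshold, ← ofReal_norm, ENNReal.ofReal_rpow_of_pos hv, ENNReal.ofReal_mul hθ.le]
  have hT0 : linkThreshold θ α p ≠ 0 := by
    rw [hT]
    simpa using mul_pos hθ (Real.rpow_pos_of_pos hv α)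
  have hTt : linkThreshold θ α p ≠ ∞ := hT ▸ ENNReal.ofReal_ne_top
  set T := linkThreshold θ α p with hTdef
  have hf : Continuous (Function.uncurry fun w x : Plane =>
      negLog (meanFadingFactor γ α T (x - (w + p.2)))) :=
    continuous_negLog.comp ((continuous_meanFadingFactor γ α hTt).comp
      (continuous_snd.sub (continuous_fst.add continuous_const)))
  -- The receiver lies in `B` exactly when its center lies in this translate, which has the same
  -- area.
  have hA : MeasurableSet ((fun w => w + p.2) ⁻¹' B) := measurable_add_const p.2 hB
  have hAvol : volume ((fun w => w + p.2) ⁻¹' B) = volume B := measure_preimage_add_right _ _ _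
  have h := hN.poisson.mecke hf
    (fun w x => negLog_ne_top (meanFadingFactor_ne_zero γ hTt _)) hA (by rwa [hAvol])
  have hin : ∀ w : Plane, ∫⁻ x, (1 - expNeg (negLog (meanFadingFactor γ α T (x - (w + p.2))))) =
      T ^ (2 / α) * ENNReal.ofReal
        (Real.pi * Real.Gamma (1 + 2 / α) * Real.Gamma (1 - 2 / α)) := by
    intro w
    simp_rw [expNeg_negLog (meanFadingFactor_le_one γ α T _)]
    rw [lintegral_sub_right_eq_self (fun x => 1 - meanFadingFactor γ α T x),
      lintegral_one_sub_meanFadingFactor γ α hTt, lintegral_one_sub_fadingFactor hα hT0 hTt]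
  simp_rw [hin] at h
  rw [setLIntegral_const, hAvol] at h
  refine h.trans ?_
  have hG1 : 0 < Real.Gamma (1 + 2 / α) := Real.Gamma_pos_of_pos (by positivity)
  have hG2 : 0 < Real.Gamma (1 - 2 / α) := Real.Gamma_pos_of_pos (by linarith)
  have hpow : (θ * ‖p.1 - p.2‖ ^ α) ^ (2 / α) = θ ^ (2 / α) * ‖p.1 - p.2‖ ^ 2 := by
    rw [Real.mul_rpow hθ.le (by positivity), ← Real.rpow_mul hv.le, mul_div_cancel₀ _ hα0.ne',
      Real.rpow_two]
  rw [hT, ENNReal.ofReal_rpow_of_pos (by positivity), hpow, ← ENNReal.ofReal_mul (by positivity),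
    ← ENNReal.ofReal_mul hlam.le, expNeg_ofReal (by positivity), mul_right_comm]
  congr 4
  ring

theorem lintegral_tsum_covered (hN : N.IsGaussianRayleigh μ lam σ) {Pd α θ : ℝ}
    (hlam : 0 < lam) (hσ : 0 < σ) (hPd : 0 < Pd) (hα : 2 < α) (hθ : 0 < θ) {B : Set Plane}
    (hB : MeasurableSet B) (hB' : volume B ≠ ∞) :
    ∫⁻ ω, ∑' i, {ω' | N.receiver i ω' ∈ B ∧ ENNReal.ofReal θ < N.sir Pd α i ω'}.indicator
      (fun _ => 1) ω ∂μ =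
      ENNReal.ofReal lam * volume B * ENNReal.ofReal (1 / (4 * σ ^ 2 * coverageZ lam θ α σ)) := by
  have hγ := hN.isProbabilityMeasure_displacementLaw
  set γ := displacementLaw σ with hγdef
  have hΦ : ∀ i, Measurable ({p | (canonical n).receiver i p ∈ B ∧
      ENNReal.ofReal θ < (canonical n).sir Pd α i p}.indicator (fun _ => (1 : ℝ≥0∞))) := fun i =>
    measurable_const.indicator (measurableSet_canonical_covered hB Pd α θ i)
  have hing : Measurable fun ω => N.ingredients ω ω ω ω :=
    hN.measurable_centers.prodMk (hN.measurable_displacements.prodMk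
      (hN.measurable_fadings.prodMk hN.measurable_schedule))
  have hmeas : ∀ i, Measurable fun ω => {ω' | N.receiver i ω' ∈ B ∧
      ENNReal.ofReal θ < N.sir Pd α i ω'}.indicator (fun _ => (1 : ℝ≥0∞)) ω :=
    fun i => (hΦ i).comp hing
  have hterm : ∀ i, ∫⁻ ω, {ω' | N.receiver i ω' ∈ B ∧
      ENNReal.ofReal θ < N.sir Pd α i ω'}.indicator (fun _ => 1) ω ∂μ =
      ∫⁻ p, ∫⁻ ω, conditionalCoverage γ α θ B i (fun j => N.center j ω) p ∂μ ∂(γ.prod γ) := by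
    intro i
    refine (hN.lintegral_ingredients (hΦ i)).trans ?_
    simp_rw [hN.lintegral_displacement_covered hPd hθ hB i]
    -- The conditional coverage no longer depends on the schedule, so that integral is trivial.
    simp only [lintegral_const, measure_univ, mul_one]
    refine lintegral_lintegral_swap ?_
    exact ((measurable_conditionalCoverage γ α θ hB i).comp
      ((hN.measurable_centers.comp measurable_fst).prodMk measurable_snd)).aemeasurable
  have hcm : ∀ i, Measurable fun p : Plane × Plane =>
      ∫⁻ ω, conditionalCoverage γ α θ B i (fun j => N.center j ω) p ∂μ := fun i =>
    Measurable.lintegral_prod_right' (f := fun q : (Plane × Plane) × Ω =>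
      conditionalCoverage γ α θ B i (fun j => N.center j q.2) q.1)
      ((measurable_conditionalCoverage γ α θ hB i).comp
        ((hN.measurable_centers.comp measurable_snd).prodMk measurable_fst))
  rw [lintegral_tsum fun i => (hmeas i).aemeasurable, tsum_congr hterm,
    ← lintegral_tsum fun i => (hcm i).aemeasurable,
    lintegral_congr_ae ((ae_prod_fst_ne_snd γ).mono fun p hp =>
      hN.tsum_lintegral_conditionalCoverage hlam hα hθ hB hB' hp)]
  have hα0 : 0 < α := by linarith
  have h2α : 2 / α < 1 := (div_lt_one hα0).2 hα
  have hG1 : 0 < Real.Gamma (1 + 2 / α) := Real.Gamma_pos_of_pos (by positivity)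
  have hG2 : 0 < Real.Gamma (1 - 2 / α) := Real.Gamma_pos_of_pos (by linarith)
  set c := Real.pi * lam * θ ^ (2 / α) * Real.Gamma (1 + 2 / α) * Real.Gamma (1 - 2 / α) with hc
  have hc0 : 0 ≤ c := by positivity
  have hm : Measurable fun p : Plane × Plane =>
      ENNReal.ofReal (Real.exp (-(c * ‖p.1 - p.2‖ ^ 2))) := by fun_prop
  rw [lintegral_const_mul _ hm, lintegral_prod_symm _ hm.aemeasurable,
    lintegral_lintegral_exp_neg_mul_sq_dist hσ hc0]
  congr 3
  -- The match is `4 σ² 𝒵 = 1 + 4 σ² c`.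
  rw [coverageZ, ← hc]
  field_simp
  ring

/-- For each fixed displacement `z`, the mean number of centers in the translate `B - z` is `lam
|B|`; averaging over `z` changes nothing. -/
theorem lintegral_tsum_receiver (hN : N.IsGaussianRayleigh μ lam σ) {B : Set Plane}
    (hB : MeasurableSet B) :
    ∫⁻ ω, ∑' i, {ω' | N.receiver i ω' ∈ B}.indicator (fun _ => 1) ω ∂μ =
      ENNReal.ofReal lam * volume B := by
  have hγ := hN.isProbabilityMeasure_displacementLaw
  set γ := displacementLaw σ with hγdef
  have hΦ : ∀ i, Measurable ({p | (canonical n).receiver i p ∈ B}.indicator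
      (fun _ => (1 : ℝ≥0∞))) := fun i =>
    measurable_const.indicator (measurable_canonical_receiver i hB)
  have hing : Measurable fun ω => N.ingredients ω ω ω ω :=
    hN.measurable_centers.prodMk (hN.measurable_displacements.prodMk
      (hN.measurable_fadings.prodMk hN.measurable_schedule))
  have hBm : Measurable (B.indicator (1 : Plane → ℝ≥0∞)) := measurable_one.indicator hB
  have hmeas : ∀ i, Measurable fun ω =>
      {ω' | N.receiver i ω' ∈ B}.indicator (fun _ => (1 : ℝ≥0∞)) ω :=
    fun i => (hΦ i).comp hing
  have hterm : ∀ i, ∫⁻ ω, {ω' | N.receiver i ω' ∈ B}.indicator (fun _ => 1) ω ∂μ =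
      ∫⁻ z, ∫⁻ ω, ((fun w => w + z) ⁻¹' B).indicator 1 (N.center i ω) ∂μ ∂γ := by
    intro i
    refine (hN.lintegral_ingredients (hΦ i)).trans ?_
    have hin : ∀ ω₁ ω₄, ∫⁻ ω₂, ∫⁻ ω₃, {p | (canonical n).receiver i p ∈ B}.indicator
        (fun _ => 1) (N.ingredients ω₁ ω₂ ω₃ ω₄) ∂μ ∂μ =
        ∫⁻ z, B.indicator 1 (N.center i ω₁ + z) ∂γ := by
      intro ω₁ ω₄
      have hm : Measurable fun z => B.indicator (1 : Plane → ℝ≥0∞) (N.center i ω₁ + z) :=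
        hBm.comp (measurable_const_add _)
      rw [hγdef, ← hN.displacement_law i (N.rx i ω₄), lintegral_map hm (hN.measurable_displacement _ _)]
      refine lintegral_congr fun ω₂ => ?_
      refine (lintegral_const (B.indicator 1
        (N.center i ω₁ + N.displacement i (N.rx i ω₄) ω₂))).trans ?_
      simp
    simp_rw [hin]
    simp only [lintegral_const, measure_univ, mul_one]
    refine lintegral_lintegral_swap ?_
    exact (hBm.comp (((hN.poisson.measurable i).comp measurable_fst).add
      measurable_snd)).aemeasurable
  have hcm : ∀ i, Measurable fun z : Plane =>
      ∫⁻ ω, ((fun w => w + z) ⁻¹' B).indicator 1 (N.center i ω) ∂μ := by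
    intro i
    have h : Measurable fun q : Plane × Ω => B.indicator (1 : Plane → ℝ≥0∞)
        (N.center i q.2 + q.1) :=
      hBm.comp (((hN.poisson.measurable i).comp measurable_snd).add measurable_fst)
    exact h.lintegral_prod_right'
  rw [lintegral_tsum fun i => (hmeas i).aemeasurable, tsum_congr hterm,
    ← lintegral_tsum fun i => (hcm i).aemeasurable]
  have hz : ∀ z : Plane, ∑' i, ∫⁻ ω, ((fun w => w + z) ⁻¹' B).indicator 1 (N.center i ω) ∂μ =
      ENNReal.ofReal lam * volume B := by
    intro z
    rw [hN.poisson.tsum_lintegral_indicator (measurable_add_const z hB),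
      measure_preimage_add_right]
  rw [lintegral_congr hz]
  simp

end D2DNetwork.IsGaussianRayleigh

theorem lemma2 {Ω : Type*} [MeasurableSpace Ω] (μ : Measure Ω) [IsProbabilityMeasure μ]
    {n : ℕ} (N : D2DNetwork Ω n) (lam σ Pd α θ : ℝ)
    (hlam : 0 < lam) (hσ : 0 < σ) (hPd : 0 < Pd) (hα : 2 < α) (hθ : 0 < θ)
    (hN : N.IsGaussianRayleigh μ lam σ)
    (B : Set Plane) (hB : MeasurableSet B) (hB0 : volume B ≠ 0) (hBtop : volume B ≠ ∞) :
    N.coverageProb μ Pd α θ B = ENNReal.ofReal (1 / (4 * σ ^ 2 * coverageZ lam θ α σ)) := by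
  rw [D2DNetwork.coverageProb, hN.lintegral_tsum_covered hlam hσ hPd hα hθ hB hBtop,
    hN.lintegral_tsum_receiver hB, mul_comm]
  exact ENNReal.mul_div_cancel_right (mul_ne_zero (by simpa using hlam) hB0)
    (ENNReal.mul_ne_top ENNReal.ofReal_ne_top hBtop)
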